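/- All Hilbert spaces are finite-dimensional and complex. A superoperator from $\mathcal H$ to $\mathcal K$ is a linear map $\mathcal B(\mathcal H)\to\mathcal B(\mathcal K)$; $\mathrm{CP}(\mathcal H,\mathcal K)$ is the set of the completely positive ones, and $\mathcal N\le_{\mathrm{CP}}\mathcal M$ means $\mathcal M-\mathcal N\in\mathrm{CP}(\mathcal H,\mathcal K)$. Let $f:(0,+\infty)\to\mathbb R$ be operator convex, and put $\tilde f(x):=xf(1/x)$, $f(0^+):=\lim_{x\searrow0}f(x)$, $\tilde f(0^+):=\lim_{x\searrow0}\tilde f(x)$. For positive semidefinite $A,B\in\mathcal B(\mathcal H)$ let $A^0$ be the projection onto $(\ker A)^\perp$, and let $$P_f(A,B):=\lim_{\varepsilon\searrow0}B_\varepsilon^{1/2}f\big(B_\varepsilon^{-1/2}A_\varepsilon B_\varepsilon^{-1/2}\big)B_\varepsilon^{1/2},\qquad A_\varepsilon:=A+\varepsilon I,\ B_\varepsilon:=B+\varepsilon I;$$ $P_f(A,B)$ is said to be defined if the limit exists. A Choi vector on $\mathcal H$ is a vector $\Psi=\sum_i\tilde e_i\otimes e_i\in\tilde{\mathcal H}\otimes\mathcal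 H$, where $(e_i)$ and $(\tilde e_i)$ are orthonormal bases of $\mathcal H$ and of a Hilbert space $\tilde{\mathcal H}$ with $\dim\tilde{\mathcal H}=\dim\mathcal H$; it gives the isomorphism $C_\Psi(\mathcal N):=(\mathrm{id}_{\mathcal B(\tilde{\mathcal H})}\otimes\mathcal N)(|\Psi\rangle\langle\Psi|)$ from superoperators $\mathcal B(\mathcal H)\to\mathcal B(\mathcal K)$ onto $\mathcal B(\tilde{\mathcal H}\otimes\mathcal K)$. For $\mathcal N,\mathcal M\in\mathrm{CP}(\mathcal H,\mathcal K)$, the superoperator perspective is $$P_f(\mathcal N,\mathcal M):=C_\Psi^{-1}\big(P_f(C_\Psi(\mathcal N),C_\Psi(\mathcal M))\big),$$ and is said to be defined if $P_f(C_\Psi(\mathcal N),C_\Psi(\mathcal M))$ is. Let $\mathcal N,\mathcal M\in\mathrm{CP}(\mathcal H,\mathcal K)$ be such that for some Choi vector $\Psi$ on $\mathcal H$, $A:=C_\Psi(\mathcal N)$ and $B:=C_\Psi(\mathcal M)$ satisfy at least one of - (S1) $A^0=B^0$; - (S2) $f(0^+)<+\infty$ and $\tilde f(0^+)<+\infty$;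 - (S3) $f(0^+)<+\infty$ and $A^0\le B^0$; - (S4) $\tilde f(0^+)<+\infty$ and $A^0\ge B^0$. Then at least one of (S1)–(S4) holds for every Choi vector on $\mathcal H$, $P_f(\mathcal N,\mathcal M)$ is defined and does not depend on the Choi vector, and the following hold (each perspective on a left-hand side being defined, and the statement being true, for every choice of the Choi vector): 1. (Post-processing) For every $\mathcal F\in\mathrm{CP}(\mathcal K,\mathcal L)$, $P_f(\mathcal F\circ\mathcal N,\mathcal F\circ\mathcal M)$ is defined and $$P_f(\mathcal F\circ\mathcal N,\mathcal F\circ\mathcal M)\le_{\mathrm{CP}}\mathcal F\circ P_f(\mathcal N,\mathcal M),$$ with equality if $\mathcal F$ has a completely positive inverse. 2. (Pre-processing) For every $\mathcal E\in\mathrm{CP}(\mathcal L,\mathcal H)$, $P_f(\mathcal N\circ\mathcal E,\mathcal M\circ\mathcal E)$ is defined and $$P_f(\mathcal N\circ\mathcal E,\mathcal M\circ\mathcal E)\le_{\mathrm{CP}}P_f(\mathcal N,\mathcal M)\circ\mathcal E.$$ 3. (Supermaps) Let $\Theta$ be a completely positive supermap, that is, a linear map from superoperators $\mathcal B(\mathcal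 H)\to\mathcal B(\mathcal K)$ to superoperators $\mathcal B(\mathcal H_2)\to\mathcal B(\mathcal K_2)$ such that, for all finite-dimensional $\mathcal R,\mathcal S$, $\mathrm{id}\otimes\Theta$ maps $\mathrm{CP}(\mathcal R\otimes\mathcal H,\mathcal S\otimes\mathcal K)$ into $\mathrm{CP}(\mathcal R\otimes\mathcal H_2,\mathcal S\otimes\mathcal K_2)$. Then $P_f(\Theta(\mathcal N),\Theta(\mathcal M))$ is defined and $$P_f(\Theta(\mathcal N),\Theta(\mathcal M))\le_{\mathrm{CP}}\Theta\big(P_f(\mathcal N,\mathcal M)\big).$$ The same holds, more generally, for every linear $\Theta$ that maps $\mathrm{CP}(\mathcal H,\mathcal K)$ into $\mathrm{CP}(\mathcal H_2,\mathcal K_2)$. -/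

import Mathlib

open scoped MatrixOrder Matrix Topology ComplexOrder

/-! Finite-dimensional Hilbert spaces are `ℂ^n` with a finite index type `n`, so `B(ℂ^n)` is
`Matrix n n ℂ`, and `ℂ^m ⊗ ℂ^n` is `ℂ^(m × n)`.
`A ≤ B` for matrices is the Löwner (positive semidefinite) order. -/

namespace SuperPersp

/-! ### Operator convexity and the operator perspective -/

section Operator

variable {n : Type*} [Fintype n] [DecidableEq n]

/-- `f : (0, ∞) → ℝ` (only the values on `(0, ∞)` matter) is operator convex: on positive definite
matrices of every size, `A ↦ f(A)` is convex in the Löwner order. -/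
def OperatorConvex (f : ℝ → ℝ) : Prop :=
  ∀ d : ℕ, ∀ A B : Matrix (Fin d) (Fin d) ℂ, A.PosDef → B.PosDef →
    ∀ t : ℝ, 0 ≤ t → t ≤ 1 →
      cfc f (t • A + (1 - t) • B) ≤ t • cfc f A + (1 - t) • cfc f B

/-- `B^{1/2} f(B^{-1/2} A B^{-1/2}) B^{1/2}`, for positive definite `A` and `B`. -/
noncomputable def opPerspPos (f : ℝ → ℝ) (A B : Matrix n n ℂ) : Matrix n n ℂ :=
  cfc Real.sqrt B * cfc f ((cfc Real.sqrt B)⁻¹ * A * (cfc Real.sqrt B)⁻¹) * cfc Real.sqrt B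

/-- `P_f(A, B)` is defined, i.e. `lim_{ε ↘ 0} P_f(A + εI, B + εI)` exists. -/
def OpPerspDefined (f : ℝ → ℝ) (A B : Matrix n n ℂ) : Prop :=
  ∃ C : Matrix n n ℂ,
    Filter.Tendsto (fun ε : ℝ => opPerspPos f (A + ε • 1) (B + ε • 1)) (𝓝[>] 0) (𝓝 C)

/-- The operator perspective `P_f(A, B) = lim_{ε ↘ 0} P_f(A + εI, B + εI)` of positive
semidefinite `A` and `B` (meaningful if `OpPerspDefined f A B`). -/
noncomputable def opPersp (f : ℝ → ℝ) (A B : Matrix n n ℂ) : Matrix n n ℂ :=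
  Filter.limUnder (𝓝[>] (0 : ℝ)) (fun ε : ℝ => opPerspPos f (A + ε • 1) (B + ε • 1))

/-- `A^0`, the orthogonal projection onto the support `(ker A)^⊥` of a positive semidefinite `A`. -/
noncomputable def supp (A : Matrix n n ℂ) : Matrix n n ℂ :=
  cfc (fun x : ℝ => if x = 0 then 0 else 1) A

/-- `f(0⁺) := lim_{x ↘ 0} f(x) < +∞`. For a convex `f` the limit exists in `(-∞, +∞]`, so this says
that it is a real number. -/
def FiniteAtZero (f : ℝ → ℝ) : Prop :=
  ∃ c : ℝ, Filter.Tendsto f (𝓝[>] 0) (𝓝 c)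

/-- The transpose function `x ↦ x f(1/x)` of `f`. -/
noncomputable def transposeFun (f : ℝ → ℝ) : ℝ → ℝ := fun x => x * f (1 / x)

/-- At least one of the following holds: `A^0 = B^0`; or `f(0⁺) < ∞` and `f̃(0⁺) < ∞`; or
`f(0⁺) < ∞` and `A^0 ≤ B^0`; or `f̃(0⁺) < ∞` and `A^0 ≥ B^0`, where `f̃` is the transpose of `f`. -/
def SupportCondition (f : ℝ → ℝ) (A B : Matrix n n ℂ) : Prop :=
  supp A = supp B ∨
  (FiniteAtZero f ∧ FiniteAtZero (transposeFun f)) ∨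
  (FiniteAtZero f ∧ supp A ≤ supp B) ∨
  (FiniteAtZero (transposeFun f) ∧ supp B ≤ supp A)

end Operator

/-! ### Superoperators and complete positivity -/

/-- Superoperators: linear maps from `B(ℂ^n)` to `B(ℂ^k)`. -/
abbrev SuperOp (n k : Type*) : Type _ := Matrix n n ℂ →ₗ[ℂ] Matrix k k ℂ

section CP

open scoped Matrix.Norms.L2Operator

variable {n k : Type*} [Fintype n] [DecidableEq n] [Fintype k] [DecidableEq k]

/-- `N` is completely positive, i.e. `N ∈ CP(ℂ^n, ℂ^k)`. -/
def IsCP (N : SuperOp n k) : Prop :=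
  ∃ φ : CompletelyPositiveMap (Matrix n n ℂ) (Matrix k k ℂ), φ.toLinearMap = N

/-- The order `N ≤_CP M`. -/
def LECP (N M : SuperOp n k) : Prop := IsCP (M - N)

end CP

/-! ### Choi vectors, the Choi-Jamiołkowski isomorphism, and the superoperator perspective -/

section Choi

/-- The map `X ↦ (⟨a| ⊗ I) X (|b⟩ ⊗ I)` from `B(ℂ^m ⊗ ℂ^n)` to `B(ℂ^n)`. -/
def blockAt {m n : Type*} (a b : m) : Matrix (m × n) (m × n) ℂ →ₗ[ℂ] Matrix n n ℂ where
  toFun X := Matrix.of fun i j => X (a, i) (b, j)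
  map_add' _ _ := rfl
  map_smul' _ _ := rfl

/-- The map `x ↦ |a⟩⟨b| ⊗ x` from `B(ℂ^n)` to `B(ℂ^m ⊗ ℂ^n)`. -/
def embedAt {m n : Type*} [DecidableEq m] (a b : m) :
    Matrix n n ℂ →ₗ[ℂ] Matrix (m × n) (m × n) ℂ where
  toFun x := Matrix.kroneckerMap (· * ·) (Matrix.single a b (1 : ℂ)) x
  map_add' x y := by ext; simp [mul_add]
  map_smul' c x := by ext; simp [mul_left_comm]

/-- `id_{B(ℂ^m)} ⊗ N`. -/
def idTensor (m : Type*) [Fintype m] [DecidableEq m] {n k : Type*} (N : SuperOp n k) :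
    SuperOp (m × n) (m × k) :=
  ∑ a : m, ∑ b : m, embedAt a b ∘ₗ N ∘ₗ blockAt a b

/-- A Choi vector `Ψ = ∑ⱼ ẽⱼ ⊗ eⱼ ∈ ℂ^m ⊗ ℂ^n`, where `(eⱼ)` is an orthonormal basis of `ℂ^n` and
`(ẽⱼ)` is an orthonormal basis of `ℂ^m` (so `m` and `n` have the same number of elements). -/
structure ChoiVector (m n : Type*) [Fintype m] [Fintype n] where
  vec : m × n → ℂ
  isChoi : ∃ (e : OrthonormalBasis n ℂ (EuclideanSpace ℂ n))
    (e' : OrthonormalBasis n ℂ (EuclideanSpace ℂ m)),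
      ∀ a i, vec (a, i) = ∑ j, e' j a * e j i

variable {m n k : Type*} [Fintype m] [DecidableEq m] [Fintype n]

/-- The rank one operator `|Ψ⟩⟨Ψ|`. -/
def ChoiVector.proj (Ψ : ChoiVector m n) : Matrix (m × n) (m × n) ℂ :=
  Matrix.vecMulVec Ψ.vec (star Ψ.vec)

theorem blockAt_embedAt {m n : Type*} [DecidableEq m] (a b c d : m) (x : Matrix n n ℂ) :
    blockAt a b (embedAt c d x) = if c = a ∧ d = b then x else 0 := by
  ext i j
  have : blockAt a b (embedAt c d x) i j = Matrix.single c d (1 : ℂ) a b * x i j := rfl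
  rw [this, Matrix.single_apply]
  split_ifs <;> simp

theorem blockAt_idTensor {m n k : Type*} [Fintype m] [DecidableEq m] (N : SuperOp n k)
    (X : Matrix (m × n) (m × n) ℂ) (a b : m) :
    blockAt a b (idTensor m N X) = N (blockAt a b X) := by
  simp only [idTensor, LinearMap.sum_apply, LinearMap.comp_apply, map_sum, blockAt_embedAt]
  rw [Finset.sum_eq_single a, Finset.sum_eq_single b] <;> simp +contextual

theorem ext_block {m k : Type*} {X Y : Matrix (m × k) (m × k) ℂ}
    (h : ∀ a b, blockAt a b X = blockAt a b Y) : X = Y := by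
  ext ⟨a, i⟩ ⟨b, j⟩
  exact congrFun (congrFun (h a b) i) j

theorem ChoiVector.unitary [DecidableEq n] (Ψ : ChoiVector m n) :
    (Matrix.of fun a i => Ψ.vec (a, i))ᴴ * (Matrix.of fun a i => Ψ.vec (a, i)) = 1 ∧
    (Matrix.of fun a i => Ψ.vec (a, i)) * (Matrix.of fun a i => Ψ.vec (a, i))ᴴ = 1 := by
  obtain ⟨e, e', h⟩ := Ψ.isChoi
  have hcard : Fintype.card n = Fintype.card m := by
    have := Module.finrank_eq_card_basis e'.toBasis
    simpa using this.symm
  set E : Matrix n n ℂ := Matrix.of fun i j => e j i with hE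
  set F : Matrix m n ℂ := Matrix.of fun a j => e' j a with hF
  have hU : (Matrix.of fun a i => Ψ.vec (a, i)) = F * Eᵀ := by
    ext a i
    simp [Matrix.mul_apply, h, hE, hF]
  have hEE : Eᴴ * E = 1 := by
    ext i j
    have := (orthonormal_iff_ite.mp e.orthonormal) i j
    rw [Matrix.one_apply, ← this]
    simp [Matrix.mul_apply, hE, PiLp.inner_apply, mul_comm]
  have hFF : Fᴴ * F = 1 := by
    ext i j
    have := (orthonormal_iff_ite.mp e'.orthonormal) i j
    rw [Matrix.one_apply, ← this]
    simp [Matrix.mul_apply, hF, PiLp.inner_apply, mul_comm]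
  have hEE' : E * Eᴴ = 1 := mul_eq_one_comm.mp hEE
  have hT : (Eᵀ)ᴴ * Eᵀ = 1 := by
    have := congrArg Matrix.transpose hEE'
    simpa [Matrix.transpose_mul, Matrix.conjTranspose, Matrix.transpose_map] using this
  have h1 : (F * Eᵀ)ᴴ * (F * Eᵀ) = 1 := by
    rw [Matrix.conjTranspose_mul, Matrix.mul_assoc, ← Matrix.mul_assoc Fᴴ, hFF, Matrix.one_mul, hT]
  rw [hU]
  exact ⟨h1, (Matrix.mul_eq_one_comm_of_card_eq n m ℂ hcard).mp h1⟩

/-- The Choi-Jamiołkowski isomorphism `N ↦ (id ⊗ N)(|Ψ⟩⟨Ψ|)`. -/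
noncomputable def choi (Ψ : ChoiVector m n) : SuperOp n k ≃ₗ[ℂ] Matrix (m × k) (m × k) ℂ where
  toFun N := idTensor m N Ψ.proj
  map_add' N M := ext_block fun a b => by simp [blockAt_idTensor]
  map_smul' c N := ext_block fun a b => by simp [blockAt_idTensor]
  invFun X :=
    { toFun := fun ρ => ∑ a, ∑ b,
        (∑ i, ∑ j, star (Ψ.vec (a, i)) * ρ i j * Ψ.vec (b, j)) • blockAt a b X
      map_add' := fun ρ σ => by
        simp only [Matrix.add_apply, mul_add, add_mul, Finset.sum_add_distrib, add_smul]
      map_smul' := fun c ρ => by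
        simp only [Finset.smul_sum, smul_smul, RingHom.id_apply, Matrix.smul_apply, smul_eq_mul,
          Finset.mul_sum]
        refine Finset.sum_congr rfl fun a _ => Finset.sum_congr rfl fun b _ => ?_
        congr 1
        refine Finset.sum_congr rfl fun i _ => Finset.sum_congr rfl fun j _ => ?_
        ring }
  left_inv N := by
    classical
    obtain ⟨h1, -⟩ := Ψ.unitary
    refine LinearMap.ext fun ρ => ?_
    simp only [LinearMap.coe_mk, AddHom.coe_mk, blockAt_idTensor]
    simp only [← map_smul, ← map_sum]
    congr 1
    set U : Matrix m n ℂ := Matrix.of fun a i => Ψ.vec (a, i) with hU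
    have hT : Uᵀ * Uᴴᵀ = 1 := by rw [← Matrix.transpose_mul, h1, Matrix.transpose_one]
    have h3 : ρ = Uᵀ * (Uᴴᵀ * ρ * Uᵀ) * Uᴴᵀ := by
      rw [Matrix.mul_assoc, Matrix.mul_assoc _ Uᵀ, hT, Matrix.mul_one, ← Matrix.mul_assoc, hT,
        Matrix.one_mul]
    conv_rhs => rw [h3]
    have hc : ∀ a b, ∑ i, ∑ j, star (Ψ.vec (a, i)) * ρ i j * Ψ.vec (b, j)
        = (Uᴴᵀ * ρ * Uᵀ) a b := fun a b => by
      simp only [Matrix.mul_apply, Finset.sum_mul]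
      rw [Finset.sum_comm]
      rfl
    ext p q
    have hb : ∀ a b, blockAt a b Ψ.proj p q = Uᵀ p a * Uᴴᵀ b q := fun a b => rfl
    simp only [hc, Matrix.sum_apply]
    generalize Uᴴᵀ * ρ * Uᵀ = S
    rw [Matrix.mul_apply, Finset.sum_comm]
    refine Finset.sum_congr rfl fun b _ => ?_
    rw [Matrix.mul_apply, Finset.sum_mul]
    refine Finset.sum_congr rfl fun a _ => ?_
    rw [map_smul, Matrix.smul_apply, hb, smul_eq_mul]
    ring
  right_inv X := by
    classical
    obtain ⟨-, h2⟩ := Ψ.unitary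
    refine ext_block fun a b => ?_
    rw [blockAt_idTensor]
    simp only [LinearMap.coe_mk, AddHom.coe_mk]
    set U : Matrix m n ℂ := Matrix.of fun a i => Ψ.vec (a, i) with hU
    have hc : ∀ c d, ∑ i, ∑ j, star (Ψ.vec (c, i)) * blockAt a b Ψ.proj i j * Ψ.vec (d, j)
        = (if a = c then 1 else 0) * (if d = b then 1 else 0) := fun c d => by
      rw [← Matrix.one_apply, ← Matrix.one_apply, ← h2, Matrix.mul_apply, Matrix.mul_apply,
        Finset.sum_mul_sum]
      refine Finset.sum_congr rfl fun i _ => Finset.sum_congr rfl fun j _ => ?_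
      change star (Ψ.vec (c, i)) * (Ψ.vec (a, i) * star (Ψ.vec (b, j))) * Ψ.vec (d, j)
        = Ψ.vec (a, i) * star (Ψ.vec (c, i)) * (Ψ.vec (d, j) * star (Ψ.vec (b, j)))
      ring
    simp only [hc]
    rw [Finset.sum_eq_single a, Finset.sum_eq_single b] <;> simp +contextual [eq_comm]

/-- `P_f(N, M)` is defined (with respect to the Choi vector `Ψ`). -/
def SuperPerspDefined [Fintype k] [DecidableEq k] (Ψ : ChoiVector m n) (f : ℝ → ℝ)
    (N M : SuperOp n k) : Prop :=
  OpPerspDefined f (choi Ψ N) (choi Ψ M)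

/-- The superoperator perspective `P_f(N, M) = C_Ψ⁻¹(P_f(C_Ψ(N), C_Ψ(M)))`. -/
noncomputable def superPersp [Fintype k] [DecidableEq k] (Ψ : ChoiVector m n) (f : ℝ → ℝ)
    (N M : SuperOp n k) : SuperOp n k :=
  (choi Ψ).symm (opPersp f (choi Ψ N) (choi Ψ M))

end Choi

/-! ### Supermaps -/

section Supermap

variable {n₁ k₁ n₂ k₂ : Type*}

/-- Supermaps: linear maps from superoperators to superoperators. -/
abbrev Supermap (n₁ k₁ n₂ k₂ : Type*) : Type _ := SuperOp n₁ k₁ →ₗ[ℂ] SuperOp n₂ k₂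

/-- The action `(id ⊗ Θ)(Λ)` of `Θ` on half of a bipartite superoperator
`Λ : B(ℂ^r ⊗ ℂ^n₁) → B(ℂ^s ⊗ ℂ^k₁)`; it is the linear extension of `Γ ⊗ N ↦ Γ ⊗ Θ(N)`. -/
def Supermap.idTensor {r s : Type*} [Fintype r] [DecidableEq r] [Fintype s] [DecidableEq s]
    (Θ : Supermap n₁ k₁ n₂ k₂) (Λ : SuperOp (r × n₁) (s × k₁)) : SuperOp (r × n₂) (s × k₂) :=
  ∑ a : s, ∑ b : s, ∑ c : r, ∑ d : r,
    embedAt a b ∘ₗ Θ (blockAt a b ∘ₗ Λ ∘ₗ embedAt c d) ∘ₗ blockAt c d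

variable [Fintype n₁] [DecidableEq n₁] [Fintype k₁] [DecidableEq k₁]
  [Fintype n₂] [DecidableEq n₂] [Fintype k₂] [DecidableEq k₂]

/-- `Θ` maps completely positive superoperators to completely positive superoperators. -/
def Supermap.PreservesCP (Θ : Supermap n₁ k₁ n₂ k₂) : Prop :=
  ∀ Λ : SuperOp n₁ k₁, IsCP Λ → IsCP (Θ Λ)

/-- `Θ` is a completely positive supermap: acting on half of any bipartite completely positive
superoperator, it yields a completely positive superoperator. -/
def Supermap.IsCPSupermap (Θ : Supermap n₁ k₁ n₂ k₂) : Prop :=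
  ∀ (r s : ℕ) (Λ : SuperOp (Fin r × n₁) (Fin s × k₁)), IsCP Λ → IsCP (Θ.idTensor Λ)

end Supermap

end SuperPersp

open SuperPersp

namespace SuperPersp

/-! ### Functional calculus and the operator Jensen inequality -/

section Calculus

variable {n p : Type*} [Fintype n] [DecidableEq n] [Fintype p] [DecidableEq p]

/-! For positive definite `A` and `B`, consider all decompositions `A = ∑ l i • G i`, `B = ∑ G i`
with `G i ≥ 0` and scalars `l i > 0`. Jensen's operator inequality gives `P_f(A, B) ≤ ∑ f (l i) • G
i` for each of them (`OperatorConvex.opPerspPos_sum_le`), and the spectral decomposition of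
`B^{-1/2} A B^{-1/2}` attains equality (`exists_decomposition`). So the perspective is a minimum
over decompositions. A positive linear map carries decompositions to decompositions with the same
scalars, so `P_f(T A, T B) ≤ T (P_f(A, B))` whenever all pairs are definite; positivity of `T` is
enough. Juxtaposing two decompositions gives subadditivity.

For semidefinite pairs, subadditivity makes `P_f(A + εX, B + εY) - ε P_f(X, Y)` increase as `ε ↘ 0`,
so the limit exists once there is an upper bound, and comparing two perturbations shows that their
direction is harmless (`OperatorConvex.tendsto_perturb`). Monotonicity thus passes to the limit,
existence included (`OperatorConvex.opPersp_map_le`). Each support condition supplies an upper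
bound, by forcing `f (l i) ≤ K * (1 + l i)` uniformly in `ε`.

By Choi's theorem, a supermap preserving complete positivity becomes a positive map between Choi
matrices, for any Choi vectors on the two sides. All claims are instances: composition with a
channel on either side, supermaps, and the identity supermap between two Choi vectors, which yields
independence by antisymmetry. -/

/-- Spectra are finite, so interpolating `f` on the union of both spectra gives one polynomial for
both matrices; `f` need not be continuous. -/
theorem exists_polynomial_cfc_eq (f : ℝ → ℝ) {X : Matrix n n ℂ} {Y : Matrix p p ℂ}
    (hX : X.IsHermitian) (hY : Y.IsHermitian) :
    ∃ q : Polynomial ℝ, cfc f X = Polynomial.aeval X q ∧ cfc f Y = Polynomial.aeval Y q := by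
  have hfin : (spectrum ℝ X ∪ spectrum ℝ Y).Finite :=
    X.finite_real_spectrum.union Y.finite_real_spectrum
  refine ⟨Lagrange.interpolate hfin.toFinset id f, ?_, ?_⟩
  · rw [← cfc_polynomial _ X hX.isSelfAdjoint]
    refine cfc_congr fun x hx => ?_
    exact (Lagrange.eval_interpolate_at_node f Function.injective_id.injOn
      (hfin.mem_toFinset.mpr (Or.inl hx))).symm
  · rw [← cfc_polynomial _ Y hY.isSelfAdjoint]
    refine cfc_congr fun x hx => ?_
    exact (Lagrange.eval_interpolate_at_node f Function.injective_id.injOn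
      (hfin.mem_toFinset.mpr (Or.inr hx))).symm

/-- Polynomials respect intertwining, and `V` may be rectangular. This one fact gives covariance
under relabelling and unitaries, and restriction to an invariant subspace. -/
theorem cfc_intertwine (f : ℝ → ℝ) {X : Matrix n n ℂ} {Y : Matrix p p ℂ} {V : Matrix p n ℂ}
    (hX : X.IsHermitian) (hY : Y.IsHermitian) (h : Y * V = V * X) :
    cfc f Y * V = V * cfc f X := by
  obtain ⟨q, h1, h2⟩ := exists_polynomial_cfc_eq f hX hY
  rw [h1, h2]
  clear h1 h2
  have hpow : ∀ k : ℕ, Y ^ k * V = V * X ^ k := by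
    intro k
    induction k with
    | zero => simp
    | succ k ih => rw [pow_succ, Matrix.mul_assoc, h, ← Matrix.mul_assoc, ih, Matrix.mul_assoc,
        ← pow_succ]
  induction q using Polynomial.induction_on' with
  | add a b ha hb => simp only [map_add, Matrix.add_mul, Matrix.mul_add, ha, hb]
  | monomial k r =>
    simp [Polynomial.aeval_monomial, Algebra.algebraMap_eq_smul_one, hpow]

theorem cfc_diagonal (f : ℝ → ℝ) (d : n → ℝ) :
    cfc f (Matrix.diagonal fun i => (d i : ℂ)) = Matrix.diagonal fun i => (f (d i) : ℂ) := by
  have hD : (Matrix.diagonal fun i => (d i : ℂ)).IsHermitian := by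
    rw [Matrix.IsHermitian, Matrix.diagonal_conjTranspose]
    congr 1; ext i; simp
  ext i j
  -- The basis vector `e_j`, as a column, intertwines the diagonal matrix with the `1 × 1` scalar `d
  -- j`.
  let v : Matrix n Unit ℂ := Matrix.of fun a _ => if a = j then 1 else 0
  have h1 : (Matrix.diagonal fun i => (d i : ℂ)) * v
      = v * algebraMap ℝ (Matrix Unit Unit ℂ) (d j) := by
    ext a u
    simp [v, Matrix.diagonal_mul, Matrix.algebraMap_eq_diagonal, Matrix.mul_diagonal]
    split_ifs with h <;> simp [h]
  have hU : (algebraMap ℝ (Matrix Unit Unit ℂ) (d j)).IsHermitian :=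
    (IsSelfAdjoint.all (d j)).algebraMap _
  have h2 := cfc_intertwine f hU hD h1
  rw [cfc_algebraMap] at h2
  have h3 := congrFun (congrFun h2 i) ()
  simp [v, Matrix.mul_apply, Matrix.algebraMap_eq_diagonal] at h3
  rw [h3, Matrix.diagonal_apply]
  by_cases hij : i = j <;> simp [hij]

theorem isHermitian_cfc (f : ℝ → ℝ) (X : Matrix n n ℂ) : (cfc f X).IsHermitian :=
  cfc_predicate f X

theorem conj_mono {X Y : Matrix p p ℂ} (h : X ≤ Y) (V : Matrix p n ℂ) :
    Vᴴ * X * V ≤ Vᴴ * Y * V := by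
  rw [Matrix.le_iff] at h ⊢
  have := h.conjTranspose_mul_mul_same V
  rwa [Matrix.mul_sub, Matrix.sub_mul] at this

/-- Midpoint operator convexity on an arbitrary finite index type. -/
theorem OperatorConvex.midpoint {f : ℝ → ℝ} (hf : OperatorConvex f) {A B : Matrix n n ℂ}
    (hA : A.PosDef) (hB : B.PosDef) :
    cfc f ((1 / 2 : ℝ) • A + (1 / 2 : ℝ) • B)
      ≤ (1 / 2 : ℝ) • cfc f A + (1 / 2 : ℝ) • cfc f B := by
  let e := Fintype.equivFin n
  have key : ∀ X : Matrix n n ℂ, X.IsHermitian →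
      cfc f (X.submatrix e.symm e.symm) = (cfc f X).submatrix e.symm e.symm := by
    intro X hX
    have h1 : X.submatrix e.symm e.symm * (1 : Matrix n n ℂ).submatrix e.symm id
        = (1 : Matrix n n ℂ).submatrix e.symm id * X := by
      ext i j
      rw [Matrix.mul_apply, ← e.sum_comp]
      simp [Matrix.mul_apply, Matrix.one_apply]
    have h2 := cfc_intertwine f hX (hX.submatrix e.symm) h1
    ext i j
    have h3 := congrFun (congrFun h2 i) (e.symm j)
    simpa [Matrix.mul_apply, Matrix.one_apply] using h3
  have h := hf _ (A.submatrix e.symm e.symm) (B.submatrix e.symm e.symm)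
    (hA.submatrix e.symm.injective) (hB.submatrix e.symm.injective) (1 / 2) (by norm_num)
    (by norm_num)
  rw [show (1 - 1 / 2 : ℝ) = 1 / 2 by norm_num] at h
  have hs : (1 / 2 : ℝ) • A.submatrix e.symm e.symm + (1 / 2 : ℝ) • B.submatrix e.symm e.symm
      = ((1 / 2 : ℝ) • A + (1 / 2 : ℝ) • B).submatrix e.symm e.symm := rfl
  have hH : ((1 / 2 : ℝ) • A + (1 / 2 : ℝ) • B).IsHermitian :=
    (hA.isHermitian.smul (IsSelfAdjoint.all _)).add (hB.isHermitian.smul (IsSelfAdjoint.all _))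
  rw [hs, key _ hH, key _ hA.isHermitian, key _ hB.isHermitian, Matrix.le_iff] at h
  rw [Matrix.le_iff]
  exact (Matrix.posSemidef_submatrix_equiv e.symm).mp h

/-- With `U = 2VVᴴ - 1`, the reflection in the range of `V`, the average of `D` and `UDU` leaves
that range invariant and acts on it as `VᴴDV`. Midpoint convexity for `D` and `UDU`, compressed by
`V`, is then the claim. -/
theorem OperatorConvex.jensen_isometry {f : ℝ → ℝ} (hf : OperatorConvex f) {D : Matrix p p ℂ}
    (hD : D.PosDef) {V : Matrix p n ℂ} (hV : Vᴴ * V = 1) :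
    cfc f (Vᴴ * D * V) ≤ Vᴴ * cfc f D * V := by
  set U : Matrix p p ℂ := (2 : ℝ) • (V * Vᴴ) - 1 with hU
  have hUV : U * V = V := by
    rw [hU, Matrix.sub_mul, Matrix.smul_mul, Matrix.mul_assoc, hV]
    simp [two_smul]
  have hUH : Uᴴ = U := by simp [hU, Matrix.conjTranspose_smul]
  have hVU : Vᴴ * U = Vᴴ := by
    have := congrArg Matrix.conjTranspose hUV
    rwa [Matrix.conjTranspose_mul, hUH] at this
  have hUU : U * U = 1 := by
    conv_lhs => rhs; rw [hU]
    rw [Matrix.mul_sub, Matrix.mul_smul, ← Matrix.mul_assoc, hUV, Matrix.mul_one, hU]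
    simp
  have hDU : (U * D * U).PosDef := by
    have : U * D * U = Uᴴ * D * U := by rw [hUH]
    rw [this]
    refine hD.conjTranspose_mul_mul_same ?_
    exact Matrix.mulVec_injective_of_isUnit (IsUnit.of_mul_eq_one U hUU)
  have h1 := hf.midpoint hD hDU
  have h2 := conj_mono h1 V
  set Y : Matrix p p ℂ := (1 / 2 : ℝ) • D + (1 / 2 : ℝ) • (U * D * U) with hY
  have hYH : Y.IsHermitian :=
    (hD.isHermitian.smul (IsSelfAdjoint.all _)).add (hDU.isHermitian.smul (IsSelfAdjoint.all _))
  have hXH : (Vᴴ * D * V).IsHermitian := Matrix.isHermitian_conjTranspose_mul_mul V hD.isHermitian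
  have h3 : Y * V = V * (Vᴴ * D * V) := by
    have e1 : Y * V = (1 / 2 : ℝ) • ((1 + U) * (D * V)) := by
      rw [hY, Matrix.add_mul, Matrix.smul_mul, Matrix.smul_mul, Matrix.mul_assoc (U * D), hUV,
        Matrix.mul_assoc, Matrix.add_mul, Matrix.one_mul, smul_add]
    rw [e1, hU, add_sub_cancel, Matrix.smul_mul, smul_smul]
    norm_num [Matrix.mul_assoc]
  have h4 := cfc_intertwine f hXH hYH h3
  have h5 : (U * D * U) * U = U * D := by rw [Matrix.mul_assoc, hUU, Matrix.mul_one]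
  have h6 := cfc_intertwine f hD.isHermitian hDU.isHermitian h5
  have h7 : cfc f (U * D * U) = U * cfc f D * U := by
    rw [← h6, Matrix.mul_assoc (cfc f _), hUU, Matrix.mul_one]
  rw [Matrix.mul_assoc, h4, ← Matrix.mul_assoc, hV, Matrix.one_mul, h7] at h2
  refine h2.trans_eq ?_
  have h8 : Vᴴ * (U * cfc f D * U) * V = Vᴴ * cfc f D * V := by
    rw [Matrix.mul_assoc, Matrix.mul_assoc (U * _), hUV, Matrix.mul_assoc U, ← Matrix.mul_assoc,
      hVU, Matrix.mul_assoc]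
  rw [Matrix.mul_add, Matrix.add_mul, Matrix.mul_smul, Matrix.smul_mul, Matrix.mul_smul,
    Matrix.smul_mul, h8, ← add_smul]
  norm_num

/-- Naimark dilation: writing `E i = (Y i)ᴴ * Y i` and stacking the `Y i` gives an isometry `V` that
compresses the block-scalar matrix with values `l i` to `∑ l i • E i`. -/
theorem OperatorConvex.jensen_sum {f : ℝ → ℝ} (hf : OperatorConvex f) {ι : Type*} [Fintype ι]
    [DecidableEq ι] {E : ι → Matrix n n ℂ} (hE : ∀ i, (E i).PosSemidef) (hsum : ∑ i, E i = 1)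
    {l : ι → ℝ} (hl : ∀ i, 0 < l i) :
    cfc f (∑ i, l i • E i) ≤ ∑ i, f (l i) • E i := by
  have hY : ∀ i, ∃ Y : Matrix n n ℂ, E i = Yᴴ * Y := fun i => by
    obtain ⟨Y, hY⟩ := CStarAlgebra.nonneg_iff_eq_star_mul_self.mp (hE i).nonneg
    exact ⟨Y, hY⟩
  choose Y hY using hY
  let V : Matrix (ι × n) n ℂ := Matrix.of fun a b => Y a.1 a.2 b
  have hV : ∀ g : ι → ℝ,
      Vᴴ * Matrix.diagonal (fun a : ι × n => (g a.1 : ℂ)) * V = ∑ i, g i • E i := by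
    intro g
    ext a b
    rw [Matrix.mul_apply]
    simp only [Matrix.mul_diagonal]
    simp only [Matrix.mul_apply, Fintype.sum_prod_type, Matrix.sum_apply,
      Matrix.smul_apply, hY, Finset.smul_sum, V, Matrix.conjTranspose_apply, Matrix.of_apply,
      Complex.real_smul]
    refine Finset.sum_congr rfl fun i _ => Finset.sum_congr rfl fun c _ => ?_
    ring_nf
  have h1 : Vᴴ * V = 1 := by
    have := hV 1
    simpa [hsum] using this
  have h2 := hf.jensen_isometry (D := Matrix.diagonal fun a : ι × n => (l a.1 : ℂ))
    (Matrix.posDef_diagonal_iff.mpr fun a => by exact_mod_cast hl a.1) h1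
  rwa [cfc_diagonal f (fun a : ι × n => l a.1), hV, hV (fun i => f (l i))] at h2

end Calculus

/-! ### The perspective of positive definite pairs as a minimum over decompositions -/

section Perspective

variable {n p : Type*} [Fintype n] [DecidableEq n] [Fintype p] [DecidableEq p]

theorem exists_sqrt_of_posDef {B : Matrix n n ℂ} (hB : B.PosDef) :
    ∃ R : Matrix n n ℂ, cfc Real.sqrt B = R ∧ R.IsHermitian ∧ R * R = B ∧ R * R⁻¹ = 1 ∧
      R⁻¹ * R = 1 ∧ R⁻¹.IsHermitian := by
  have hH : (cfc Real.sqrt B).IsHermitian := isHermitian_cfc _ _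
  have hRR : cfc Real.sqrt B * cfc Real.sqrt B = B := by
    rw [← cfc_mul Real.sqrt Real.sqrt B]
    conv_rhs => rw [← cfc_id ℝ B hB.isHermitian.isSelfAdjoint]
    refine cfc_congr fun x hx => ?_
    exact Real.mul_self_sqrt (spectrum_nonneg_of_nonneg hB.posSemidef.nonneg hx)
  have hu : IsUnit (cfc Real.sqrt B).det := by
    have : IsUnit (cfc Real.sqrt B * cfc Real.sqrt B) := by rw [hRR]; exact hB.isUnit
    rw [Matrix.isUnit_iff_isUnit_det, Matrix.det_mul] at this
    exact isUnit_of_mul_isUnit_left this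
  exact ⟨_, rfl, hH, hRR, Matrix.mul_nonsing_inv _ hu, Matrix.nonsing_inv_mul _ hu, hH.inv⟩

/-- Conjugating by `B^{-1/2}`, where `B = ∑ G i`, turns the `G i` into a resolution of the identity,
to which `jensen_sum` applies. -/
theorem OperatorConvex.opPerspPos_sum_le {f : ℝ → ℝ} (hf : OperatorConvex f) {ι : Type*}
    [Fintype ι] {G : ι → Matrix n n ℂ} (hG : ∀ i, (G i).PosSemidef)
    (hsum : (∑ i, G i).PosDef) {l : ι → ℝ} (hl : ∀ i, 0 < l i) :
    opPerspPos f (∑ i, l i • G i) (∑ i, G i) ≤ ∑ i, f (l i) • G i := by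
  classical
  obtain ⟨R, hR, hRH, hRR, h1, h2, hiH⟩ := exists_sqrt_of_posDef hsum
  have hconj : ∀ g : ι → ℝ, R⁻¹ * (∑ i, g i • G i) * R⁻¹ = ∑ i, g i • (R⁻¹ * G i * R⁻¹) := by
    intro g
    simp only [Matrix.mul_sum, Matrix.sum_mul, Matrix.mul_smul, Matrix.smul_mul]
  have hE : ∀ i, (R⁻¹ * G i * R⁻¹).PosSemidef := fun i => by
    have := (hG i).conjTranspose_mul_mul_same R⁻¹
    rwa [hiH.eq] at this
  have hE1 : ∑ i, R⁻¹ * G i * R⁻¹ = 1 := by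
    have := hconj 1
    simp only [Pi.one_apply, one_smul] at this
    rw [← this, ← hRR, ← Matrix.mul_assoc, h2, Matrix.one_mul, h1]
  have h := conj_mono (hf.jensen_sum hE hE1 hl) R
  rw [hRH.eq] at h
  rw [opPerspPos, hR, hconj]
  refine h.trans_eq ?_
  rw [← hconj (fun i => f (l i))]
  simp only [Matrix.mul_assoc, h2, Matrix.mul_one]
  rw [← Matrix.mul_assoc, h1, Matrix.one_mul]

/-- Simultaneous decomposition of a pair of positive definite matrices. -/
theorem exists_decomposition (f : ℝ → ℝ) {A B : Matrix n n ℂ} (hA : A.PosDef) (hB : B.PosDef) :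
    ∃ (G : n → Matrix n n ℂ) (l : n → ℝ), (∀ i, (G i).PosSemidef) ∧ (∀ i, 0 < l i) ∧
      ∑ i, G i = B ∧ ∑ i, l i • G i = A ∧ opPerspPos f A B = ∑ i, f (l i) • G i ∧
      (∀ c : ℝ, A ≤ c • B → ∀ i, l i ≤ c) ∧ (∀ c : ℝ, c • B ≤ A → ∀ i, c ≤ l i) := by
  obtain ⟨R, hR, hRH, hRR, h1, h2, hiH⟩ := exists_sqrt_of_posDef hB
  have hX : (R⁻¹ * A * R⁻¹).PosDef := by
    have := hA.conjTranspose_mul_mul_same (B := R⁻¹)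
      (Matrix.mulVec_injective_of_isUnit (IsUnit.of_mul_eq_one _ h2))
    rwa [hiH.eq] at this
  set X := R⁻¹ * A * R⁻¹ with hXdef
  have hXH := hX.isHermitian
  let U : Matrix n n ℂ := hXH.eigenvectorUnitary.1
  have hUU : U * Uᴴ = 1 := Unitary.coe_mul_star_self hXH.eigenvectorUnitary
  have hUU' : Uᴴ * U = 1 := Unitary.coe_star_mul_self hXH.eigenvectorUnitary
  let S : Matrix n n ℂ := R * U
  let S' : Matrix n n ℂ := Uᴴ * R⁻¹
  let G : n → Matrix n n ℂ := fun i => S * Matrix.single i i 1 * Sᴴ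
  have hS' : S' * S = 1 := by
    simp only [S, S']
    rw [Matrix.mul_assoc, ← Matrix.mul_assoc R⁻¹, h2, Matrix.one_mul, hUU']
  have hsum : ∀ g : n → ℝ, ∑ i, g i • G i = S * Matrix.diagonal (fun i => (g i : ℂ)) * Sᴴ := by
    intro g
    have hd : Matrix.diagonal (fun i => (g i : ℂ)) = ∑ i, g i • Matrix.single i i (1 : ℂ) := by
      ext a b
      simp [Matrix.sum_apply, Matrix.single_apply, Matrix.diagonal_apply, ite_and]
    rw [hd, Matrix.mul_sum, Matrix.sum_mul]
    simp only [G, Matrix.mul_smul, Matrix.smul_mul]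
  have hSH : Sᴴ = Uᴴ * R := by simp only [S]; rw [Matrix.conjTranspose_mul, hRH.eq]
  have hcfc : ∀ g : ℝ → ℝ, cfc g X =
      U * Matrix.diagonal (fun i => (g (hXH.eigenvalues i) : ℂ)) * Uᴴ := by
    intro g
    rw [hXH.cfc_eq, Matrix.IsHermitian.cfc, Unitary.conjStarAlgAut_apply]
    rfl
  have hcfc' : ∀ g : ℝ → ℝ, ∑ i, g (hXH.eigenvalues i) • G i = R * cfc g X * R := by
    intro g
    rw [hsum (fun i => g (hXH.eigenvalues i)), hcfc, hSH]
    simp only [S, Matrix.mul_assoc]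
  have hAX : R * X * R = A := by
    rw [hXdef, Matrix.mul_assoc, Matrix.mul_assoc, Matrix.mul_assoc, h2, Matrix.mul_one,
      ← Matrix.mul_assoc, h1, Matrix.one_mul]
  have hAsum : ∑ i, hXH.eigenvalues i • G i = A := by
    have := hcfc' id
    rw [cfc_id ℝ X hXH.isSelfAdjoint, hAX] at this
    exact this
  have hBsum : ∑ i, G i = B := by
    have := hcfc' 1
    rw [cfc_one ℝ X hXH.isSelfAdjoint, Matrix.mul_one, hRR] at this
    simpa using this
  -- `S` is invertible, so congruence by `S'` turns `∑ g i • G i` into the diagonal matrix of `g`;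
  -- Löwner bounds between `A` and `B` thus become bounds on each `l i`.
  have hdiag : ∀ g : n → ℝ, 0 ≤ ∑ i, g i • G i → ∀ i, 0 ≤ g i := by
    intro g hg i
    have h3 := conj_mono hg S'ᴴ
    have hSS : Sᴴ * S'ᴴ = 1 := by rw [← Matrix.conjTranspose_mul, hS', Matrix.conjTranspose_one]
    rw [hsum, Matrix.mul_zero, Matrix.zero_mul, Matrix.conjTranspose_conjTranspose,
      ← Matrix.mul_assoc, ← Matrix.mul_assoc, hS',
      Matrix.one_mul, Matrix.mul_assoc, hSS, Matrix.mul_one,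
      Matrix.nonneg_iff_posSemidef, Matrix.posSemidef_diagonal_iff] at h3
    exact_mod_cast h3 i
  refine ⟨G, hXH.eigenvalues, fun i => ?_, fun i => hX.eigenvalues_pos i, hBsum, hAsum, ?_, ?_, ?_⟩
  · refine Matrix.PosSemidef.mul_mul_conjTranspose_same ?_ S
    rw [← Matrix.diagonal_single]
    refine Matrix.posSemidef_diagonal_iff.mpr fun j => ?_
    by_cases h : j = i
    · subst h; simp
    · simp [h]
  · rw [opPerspPos, hR, ← hXdef, hcfc']
  · intro c hc i
    have := hdiag (fun i => c - hXH.eigenvalues i) (by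
      simp only [sub_smul, Finset.sum_sub_distrib, ← Finset.smul_sum, hAsum, hBsum]
      exact sub_nonneg.mpr hc) i
    linarith
  · intro c hc i
    have := hdiag (fun i => hXH.eigenvalues i - c) (by
      simp only [sub_smul, Finset.sum_sub_distrib, ← Finset.smul_sum, hAsum, hBsum]
      exact sub_nonneg.mpr hc) i
    linarith

theorem OperatorConvex.opPerspPos_add_le {f : ℝ → ℝ} (hf : OperatorConvex f)
    {A B X Y : Matrix n n ℂ} (hA : A.PosDef) (hB : B.PosDef) (hX : X.PosDef) (hY : Y.PosDef) :
    opPerspPos f (A + X) (B + Y) ≤ opPerspPos f A B + opPerspPos f X Y := by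
  obtain ⟨G, l, hG, hl, hGB, hGA, hP, -⟩ := exists_decomposition f hA hB
  obtain ⟨G', l', hG', hl', hGB', hGA', hP', -⟩ := exists_decomposition f hX hY
  have h := hf.opPerspPos_sum_le (G := Sum.elim G G') (l := Sum.elim l l')
    (by rintro (i | i); exacts [hG i, hG' i])
    (by simpa [hGB, hGB'] using hB.add hY) (by rintro (i | i); exacts [hl i, hl' i])
  simpa [hGB, hGB', hGA, hGA', hP, hP'] using h

theorem OperatorConvex.opPerspPos_map_add_le {f : ℝ → ℝ} (hf : OperatorConvex f)
    {T : Matrix n n ℂ →ₗ[ℂ] Matrix p p ℂ} (hT : ∀ Z, Z.PosSemidef → (T Z).PosSemidef)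
    {A B : Matrix n n ℂ} {X : Matrix p p ℂ} (hA : A.PosDef) (hB : B.PosDef) (hX : X.PosDef) :
    opPerspPos f (T A + X) (T B + X) ≤ T (opPerspPos f A B) + f 1 • X := by
  obtain ⟨G, l, hG, hl, hGB, hGA, hP, -⟩ := exists_decomposition f hA hB
  -- The summand `X` enters both arguments with coefficient `1`, hence costs `f 1 • X`; it makes the
  -- sum definite even when `T B` is singular.
  have h := hf.opPerspPos_sum_le (G := fun i => Option.elim i X fun i => T (G i))
    (l := fun i => Option.elim i 1 l)
    (by rintro (_ | i); exacts [hX.posSemidef, hT _ (hG i)])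
    (by
      simp only [Fintype.sum_option, Option.elim, ← map_sum, hGB]
      exact hX.add_posSemidef (hT _ hB.posSemidef))
    (by rintro (_ | i); exacts [one_pos, hl i])
  have hs : ∀ g : n → ℝ, T (∑ i, g i • G i) = ∑ i, g i • T (G i) := fun g => by
    rw [map_sum]
    exact Finset.sum_congr rfl fun i _ => LinearMap.map_smul_of_tower T (g i) (G i)
  rw [hP, hs (fun i => f (l i)), ← hGA, hs, ← hGB, map_sum, add_comm _ X, add_comm _ X,
    add_comm _ (f 1 • X)]
  simpa [Fintype.sum_option] using h

end Perspective

/-! ### Limits of perturbed perspectives -/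

section Limits

open Filter Set

variable {n p : Type*} [Fintype n] [DecidableEq n] [Fintype p] [DecidableEq p]

open scoped Matrix.Norms.L2Operator in
instance orderClosedTopology_matrix : OrderClosedTopology (Matrix n n ℂ) := inferInstance

theorem exists_tendsto_of_antitoneOn {φ : ℝ → ℝ} (h : AntitoneOn φ (Ioi 0)) {a b : ℝ}
    (hb : ∀ ε, 0 < ε → φ ε ≤ a + ε * b) : ∃ L, Tendsto φ (𝓝[>] 0) (𝓝 L) := by
  have hbdd : BddAbove (φ '' Ioi 0) := by
    refine ⟨a + |b|, ?_⟩
    rintro _ ⟨ε, hε, rfl⟩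
    have h1 : ∀ δ, 0 < δ → δ ≤ 1 → φ δ ≤ a + |b| := fun δ hδ hδ1 => by
      refine (hb δ hδ).trans ?_
      have := le_abs_self b
      have := abs_nonneg b
      nlinarith
    rcases le_total ε 1 with h2 | h2
    · exact h1 ε hε h2
    · exact (h (mem_Ioi.mpr one_pos) hε h2).trans (h1 1 one_pos le_rfl)
  refine ⟨sSup (φ '' Ioi 0), ?_⟩
  rw [tendsto_order]
  refine ⟨fun c hc => ?_, fun c hc => ?_⟩
  · obtain ⟨_, ⟨ε, hε, rfl⟩, h1⟩ := exists_lt_of_lt_csSup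
      ⟨_, mem_image_of_mem φ (mem_Ioi.mpr one_pos)⟩ hc
    filter_upwards [Ioo_mem_nhdsGT hε] with δ hδ
    exact h1.trans_le (h hδ.1 hε hδ.2.le)
  · filter_upwards [self_mem_nhdsWithin] with δ hδ
    exact (le_csSup hbdd (mem_image_of_mem φ hδ)).trans_lt hc

/-- Each quadratic form is a bounded monotone real function, and polarization recovers the entries.
-/
theorem exists_tendsto_of_antitoneOn_matrix {M : ℝ → Matrix n n ℂ} (hM : ∀ ε, (M ε).IsHermitian)
    (h : AntitoneOn M (Ioi 0)) {C W : Matrix n n ℂ} (hb : ∀ ε : ℝ, 0 < ε → M ε ≤ C + ε • W) :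
    ∃ L, Tendsto M (𝓝[>] 0) (𝓝 L) := by
  have hle : ∀ {X Y : Matrix n n ℂ}, X ≤ Y → ∀ z : EuclideanSpace ℂ n,
      (inner ℂ (X.toEuclideanLin z) z).re ≤ (inner ℂ (Y.toEuclideanLin z) z).re := by
    intro X Y hXY z
    have := (Matrix.isPositive_toEuclideanLin_iff.mpr (Matrix.le_iff.mp hXY)).2 z
    rw [map_sub, LinearMap.sub_apply, inner_sub_left] at this
    simpa using this
  have hq : ∀ z : EuclideanSpace ℂ n,
      ∃ c : ℂ, Tendsto (fun ε => inner ℂ ((M ε).toEuclideanLin z) z) (𝓝[>] 0) (𝓝 c) := by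
    intro z
    obtain ⟨c, hc⟩ := exists_tendsto_of_antitoneOn
      (φ := fun ε => (inner ℂ ((M ε).toEuclideanLin z) z).re)
      (fun δ hδ ε hε hδε => hle (h hδ hε hδε) z)
      (a := (inner ℂ (C.toEuclideanLin z) z).re) (b := (inner ℂ (W.toEuclideanLin z) z).re)
      (fun ε hε => by
        refine (hle (hb ε hε) z).trans_eq ?_
        rw [← Complex.coe_smul ε W, map_add, map_smul, LinearMap.add_apply, LinearMap.smul_apply,
          inner_add_left, inner_smul_left]
        simp)
    refine ⟨c, ((Complex.continuous_ofReal.tendsto c).comp hc).congr fun ε => ?_⟩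
    exact (Matrix.isSymmetric_toEuclideanLin_iff.mpr (hM ε)).coe_re_inner_apply_self z
  choose Q hQ using hq
  have hent : ∀ i j, ∃ c : ℂ, Tendsto (fun ε => M ε i j) (𝓝[>] 0) (𝓝 c) := by
    intro i j
    let x : EuclideanSpace ℂ n := EuclideanSpace.single j 1
    let y : EuclideanSpace ℂ n := EuclideanSpace.single i 1
    have hpol : ∀ ε, M ε i j = inner ℂ ((M ε).toEuclideanLin y) x := by
      intro ε
      rw [(Matrix.isSymmetric_toEuclideanLin_iff.mpr (hM ε)) y x]
      simp [x, y, Matrix.toEuclideanLin, EuclideanSpace.inner_single_left]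
    have hlim := (((((hQ (x + y)).sub (hQ (x - y))).add
      ((hQ (x + Complex.I • y)).const_mul Complex.I)).sub
      ((hQ (x - Complex.I • y)).const_mul Complex.I)).div_const 4)
    exact ⟨_, hlim.congr fun ε => ((hpol ε).trans (inner_map_polarization _ x y)).symm⟩
  choose L hL using hent
  exact ⟨Matrix.of L, tendsto_pi_nhds.mpr fun i => tendsto_pi_nhds.mpr fun j => hL i j⟩

theorem isHermitian_opPerspPos (f : ℝ → ℝ) (A B : Matrix n n ℂ) :
    (opPerspPos f A B).IsHermitian := by
  have h := Matrix.isHermitian_conjTranspose_mul_mul (cfc Real.sqrt B)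
    (isHermitian_cfc f ((cfc Real.sqrt B)⁻¹ * A * (cfc Real.sqrt B)⁻¹))
  rwa [(isHermitian_cfc Real.sqrt B).eq] at h

theorem posDef_add_smul {A X : Matrix n n ℂ} (hA : A.PosSemidef) (hX : X.PosDef) {ε : ℝ}
    (hε : 0 < ε) : (A + ε • X).PosDef :=
  Matrix.PosDef.posSemidef_add hA (hX.smul hε)

theorem OperatorConvex.opPerspPos_smul_le {f : ℝ → ℝ} (hf : OperatorConvex f)
    {A B : Matrix n n ℂ} (hA : A.PosDef) (hB : B.PosDef) {c : ℝ} (hc : 0 < c) :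
    opPerspPos f (c • A) (c • B) ≤ c • opPerspPos f A B := by
  obtain ⟨G, l, hG, hl, hGB, hGA, hP, -⟩ := exists_decomposition f hA hB
  have h := hf.opPerspPos_sum_le (G := fun i => c • G i) (l := l) (fun i => (hG i).smul hc.le)
    (by rw [← Finset.smul_sum, hGB]; exact hB.smul hc) hl
  simp only [smul_comm _ c, ← Finset.smul_sum, hGB, hGA] at h
  rwa [hP]

theorem tendsto_add_smul (D E : Matrix n n ℂ) :
    Tendsto (fun ε : ℝ => D + ε • E) (𝓝[>] 0) (𝓝 D) := by
  have h : Tendsto (fun ε : ℝ => D + ε • E) (𝓝 0) (𝓝 (D + (0 : ℝ) • E)) :=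
    (continuous_const.add (continuous_id.smul continuous_const)).tendsto 0
  rw [zero_smul, add_zero] at h
  exact h.mono_left nhdsWithin_le_nhds

/-- Subadditivity splits the perturbation at `ε` into the one at `δ < ε` and the pair `(ε - δ) • (X,
Y)`, whose perspective is at most `(ε - δ) • P_f(X, Y)`. -/
theorem OperatorConvex.antitoneOn_opPerspPos_sub {f : ℝ → ℝ} (hf : OperatorConvex f)
    {A B X Y : Matrix n n ℂ} (hA : A.PosSemidef) (hB : B.PosSemidef) (hX : X.PosDef)
    (hY : Y.PosDef) :
    AntitoneOn (fun ε : ℝ => opPerspPos f (A + ε • X) (B + ε • Y) - ε • opPerspPos f X Y)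
      (Ioi 0) := by
  intro δ hδ ε hε hle
  rcases hle.eq_or_lt with rfl | hlt
  · exact le_rfl
  have hpos : 0 < ε - δ := sub_pos.mpr hlt
  have h1 := hf.opPerspPos_add_le (posDef_add_smul hA hX hδ) (posDef_add_smul hB hY hδ)
    (hX.smul hpos) (hY.smul hpos)
  have h2 := h1.trans (add_le_add_right (hf.opPerspPos_smul_le hX hY hpos) _)
  have e : ∀ D E : Matrix n n ℂ, D + δ • E + (ε - δ) • E = D + ε • E := fun D E => by module
  rw [e, e] at h2
  dsimp only
  rw [sub_le_iff_le_add]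
  refine h2.trans_eq ?_
  module

theorem OperatorConvex.opPerspPos_le_of_tendsto {f : ℝ → ℝ} (hf : OperatorConvex f)
    {A B X Y L : Matrix n n ℂ} (hA : A.PosSemidef) (hB : B.PosSemidef) (hX : X.PosDef)
    (hY : Y.PosDef)
    (hL : Tendsto (fun ε : ℝ => opPerspPos f (A + ε • X) (B + ε • Y)) (𝓝[>] 0) (𝓝 L))
    {ε : ℝ} (hε : 0 < ε) :
    opPerspPos f (A + ε • X) (B + ε • Y) ≤ L + ε • opPerspPos f X Y := by
  have hL' := hL.sub (tendsto_add_smul 0 (opPerspPos f X Y))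
  simp only [zero_add, sub_zero] at hL'
  rw [← sub_le_iff_le_add]
  refine ge_of_tendsto hL' ?_
  filter_upwards [Ioo_mem_nhdsGT hε] with δ hδ
  exact hf.antitoneOn_opPerspPos_sub hA hB hX hY hδ.1 hε hδ.2.le

/-- A perturbed perspective that is bounded above converges. -/
theorem OperatorConvex.exists_tendsto_opPerspPos {f : ℝ → ℝ} (hf : OperatorConvex f)
    {A B X Y C W : Matrix n n ℂ} (hA : A.PosSemidef) (hB : B.PosSemidef) (hX : X.PosDef)
    (hY : Y.PosDef)
    (hb : ∀ ε : ℝ, 0 < ε → opPerspPos f (A + ε • X) (B + ε • Y) ≤ C + ε • W) :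
    ∃ L, Tendsto (fun ε : ℝ => opPerspPos f (A + ε • X) (B + ε • Y)) (𝓝[>] 0) (𝓝 L) ∧ L ≤ C := by
  obtain ⟨L, hL⟩ := exists_tendsto_of_antitoneOn_matrix
    (C := C) (W := W - opPerspPos f X Y)
    (fun ε : ℝ => (isHermitian_opPerspPos f (A + ε • X) (B + ε • Y)).sub
      ((isHermitian_opPerspPos f X Y).smul (IsSelfAdjoint.all ε)))
    (hf.antitoneOn_opPerspPos_sub hA hB hX hY) (fun ε hε => by
      rw [sub_le_iff_le_add]
      refine (hb ε hε).trans_eq ?_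
      module)
  have hqL := hL.add (tendsto_add_smul 0 (opPerspPos f X Y))
  simp only [zero_add, sub_add_cancel, add_zero] at hqL
  refine ⟨L, hqL, le_of_tendsto_of_tendsto hqL (tendsto_add_smul C W) ?_⟩
  filter_upwards [self_mem_nhdsWithin] with ε hε using hb ε hε

theorem exists_posDef_sub_smul {X Y : Matrix n n ℂ} (hX : X.PosDef) (hY : Y.PosDef) :
    ∃ δ : ℝ, 0 < δ ∧ (X - δ • Y).PosDef := by
  obtain ⟨G, l, hG, hl, hGY, hGX, -⟩ := exists_decomposition (fun _ => 0) hX hY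
  obtain ⟨δ, hδ, hδl⟩ : ∃ δ : ℝ, 0 < δ ∧ ∀ i, δ ≤ l i := by
    rcases isEmpty_or_nonempty n with h | h
    · exact ⟨1, one_pos, fun i => h.elim i⟩
    · obtain ⟨i, hi⟩ := Finite.exists_min l
      exact ⟨l i, hl i, hi⟩
  refine ⟨δ / 2, half_pos hδ, ?_⟩
  have h1 : (∑ i, (l i - δ) • G i).PosSemidef :=
    Matrix.posSemidef_sum _ fun i _ => (hG i).smul (sub_nonneg.mpr (hδl i))
  simp only [sub_smul, Finset.sum_sub_distrib, ← Finset.smul_sum, hGY, hGX] at h1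
  have h2 := (hX.smul (one_half_pos (α := ℝ))).add_posSemidef
    (h1.smul (one_half_pos (α := ℝ)).le)
  convert h2 using 1
  module

/-- Writing `X' = δ • X + (X' - δ • X)` with a definite remainder, and likewise `Y'` with the same
`δ`, subadditivity bounds the new perturbation by the old one at `ε * δ` plus a term linear in `ε`.
-/
theorem OperatorConvex.tendsto_perturb {f : ℝ → ℝ} (hf : OperatorConvex f)
    {A B X Y X' Y' L : Matrix n n ℂ} (hA : A.PosSemidef) (hB : B.PosSemidef)
    (hX : X.PosDef) (hY : Y.PosDef) (hX' : X'.PosDef) (hY' : Y'.PosDef)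
    (hL : Tendsto (fun ε : ℝ => opPerspPos f (A + ε • X) (B + ε • Y)) (𝓝[>] 0) (𝓝 L)) :
    ∃ L', Tendsto (fun ε : ℝ => opPerspPos f (A + ε • X') (B + ε • Y')) (𝓝[>] 0) (𝓝 L') ∧
      L' ≤ L := by
  obtain ⟨δ₁, hδ₁, hX1⟩ := exists_posDef_sub_smul hX' hX
  obtain ⟨δ₂, hδ₂, hY1⟩ := exists_posDef_sub_smul hY' hY
  obtain ⟨δ, hδ, hXδ, hYδ⟩ : ∃ δ : ℝ, 0 < δ ∧ (X' - δ • X).PosDef ∧ (Y' - δ • Y).PosDef := by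
    have key : ∀ {D E : Matrix n n ℂ} {a b : ℝ}, E.PosDef → b ≤ a → (D - a • E).PosDef →
        (D - b • E).PosDef := fun {D E a b} hE hba h => by
      have := h.add_posSemidef (hE.posSemidef.smul (sub_nonneg.mpr hba))
      convert this using 1
      module
    exact ⟨min δ₁ δ₂, lt_min hδ₁ hδ₂, key hX (min_le_left _ _) hX1, key hY (min_le_right _ _) hY1⟩
  exact hf.exists_tendsto_opPerspPos (C := L)
    (W := δ • opPerspPos f X Y + opPerspPos f (X' - δ • X) (Y' - δ • Y)) hA hB hX' hY'
    (fun ε hε => by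
      have h := hf.opPerspPos_add_le (posDef_add_smul hA hX (mul_pos hε hδ))
        (posDef_add_smul hB hY (mul_pos hε hδ)) (hXδ.smul hε) (hYδ.smul hε)
      have e : ∀ D E E' : Matrix n n ℂ, D + (ε * δ) • E + ε • (E' - δ • E) = D + ε • E' :=
        fun D E E' => by module
      rw [e, e] at h
      refine h.trans ((add_le_add (hf.opPerspPos_le_of_tendsto hA hB hX hY hL (mul_pos hε hδ))
        (hf.opPerspPos_smul_le hXδ hYδ hε)).trans_eq ?_)
      module)

theorem opPersp_eq_of_tendsto {f : ℝ → ℝ} {A B L : Matrix n n ℂ}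
    (h : Tendsto (fun ε : ℝ => opPerspPos f (A + ε • 1) (B + ε • 1)) (𝓝[>] 0) (𝓝 L)) :
    opPersp f A B = L :=
  h.limUnder_eq

theorem OperatorConvex.opPerspDefined_of_le {f : ℝ → ℝ} (hf : OperatorConvex f)
    {A B C W : Matrix n n ℂ} (hA : A.PosSemidef) (hB : B.PosSemidef)
    (hb : ∀ ε : ℝ, 0 < ε → opPerspPos f (A + ε • 1) (B + ε • 1) ≤ C + ε • W) :
    OpPerspDefined f A B := by
  obtain ⟨L, hL, -⟩ := hf.exists_tendsto_opPerspPos hA hB Matrix.PosDef.one Matrix.PosDef.one hb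
  exact ⟨L, hL⟩

theorem map_mono_of_posSemidef {T : Matrix n n ℂ →ₗ[ℂ] Matrix p p ℂ}
    (hT : ∀ Z, Z.PosSemidef → (T Z).PosSemidef) {A B : Matrix n n ℂ} (h : A ≤ B) : T A ≤ T B := by
  have := hT _ (Matrix.le_iff.mp h)
  rwa [map_sub] at this

/-- Monotonicity of the operator perspective under positive maps. -/
theorem OperatorConvex.opPersp_map_le {f : ℝ → ℝ} (hf : OperatorConvex f)
    {T : Matrix n n ℂ →ₗ[ℂ] Matrix p p ℂ} (hT : ∀ Z, Z.PosSemidef → (T Z).PosSemidef)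
    {A B : Matrix n n ℂ} (hA : A.PosSemidef) (hB : B.PosSemidef) (h : OpPerspDefined f A B) :
    OpPerspDefined f (T A) (T B) ∧ opPersp f (T A) (T B) ≤ T (opPersp f A B) := by
  obtain ⟨L, hL⟩ := h
  rw [opPersp_eq_of_tendsto hL]
  have h1 := Matrix.PosDef.one (n := n) (R := ℂ)
  have h1' := Matrix.PosDef.one (n := p) (R := ℂ)
  -- The image of `A + ε • 1` is perturbed by `T 1`, which may be singular; adding `ε • 1` restores
  -- definiteness. `tendsto_perturb` later replaces the direction `X` by `1`.
  set X : Matrix p p ℂ := T 1 + 1 with hXdef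
  have hX : X.PosDef := Matrix.PosDef.posSemidef_add (hT 1 h1.posSemidef) h1'
  obtain ⟨L', hL', hL'L⟩ := hf.exists_tendsto_opPerspPos (C := T L)
    (W := T (opPerspPos f 1 1) + f 1 • 1) (hT A hA) (hT B hB) hX hX (fun ε hε => by
      have h2 := hf.opPerspPos_map_add_le hT (posDef_add_smul hA h1 hε) (posDef_add_smul hB h1 hε)
        (h1'.smul hε)
      have e : ∀ D : Matrix n n ℂ, T (D + ε • 1) + ε • 1 = T D + ε • X := fun D => by
        rw [map_add, LinearMap.map_smul_of_tower, hXdef]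
        module
      rw [e, e] at h2
      refine h2.trans ((add_le_add_left
        (map_mono_of_posSemidef hT (hf.opPerspPos_le_of_tendsto hA hB h1 h1 hL hε)) _).trans_eq ?_)
      rw [map_add, LinearMap.map_smul_of_tower]
      module)
  obtain ⟨L'', hL'', hle⟩ := hf.tendsto_perturb (hT A hA) (hT B hB) hX hX h1' h1' hL'
  exact ⟨⟨L'', hL''⟩, (opPersp_eq_of_tendsto hL'').trans_le (hle.trans hL'L)⟩

end Limits

/-! ### Scalar growth bounds on `f` -/

section Scalar

open Filter Set

theorem OperatorConvex.convexOn {f : ℝ → ℝ} (hf : OperatorConvex f) : ConvexOn ℝ (Ioi 0) f := by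
  refine ⟨convex_Ioi 0, fun x hx y hy a b ha hb hab => ?_⟩
  have hpd : ∀ {z : ℝ}, 0 < z → (algebraMap ℝ (Matrix (Fin 1) (Fin 1) ℂ) z).PosDef := fun hz => by
    rw [Algebra.algebraMap_eq_smul_one]
    exact Matrix.PosDef.one.smul hz
  have h := hf 1 _ _ (hpd hx) (hpd hy) a ha (by linarith)
  rw [show 1 - a = b by linarith, Algebra.smul_def, Algebra.smul_def, ← map_mul, ← map_mul,
    ← map_add, cfc_algebraMap, cfc_algebraMap, cfc_algebraMap, Algebra.smul_def, Algebra.smul_def,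
    ← map_mul, ← map_mul, ← map_add, Matrix.le_iff, ← map_sub] at h
  have h0 := h.diag_nonneg (i := 0)
  rw [Matrix.algebraMap_matrix_apply, if_pos rfl, Complex.coe_algebraMap] at h0
  have h1 : (0 : ℝ) ≤ a * f x + b * f y - f (a * x + b * y) := by exact_mod_cast h0
  simpa using h1

theorem OperatorConvex.bddOn_Icc {f : ℝ → ℝ} (hf : OperatorConvex f) (a b : ℝ) (ha : 0 < a) :
    ∃ K, 0 ≤ K ∧ ∀ x ∈ Icc a b, f x ≤ K := by
  refine ⟨max 0 (max (f a) (f b)), le_max_left _ _, fun x hx => le_max_of_le_right ?_⟩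
  exact hf.convexOn.le_max_of_mem_Icc ha (ha.trans_le (hx.1.trans hx.2)) hx

theorem FiniteAtZero.bddOn_Ioc {g : ℝ → ℝ} (hg : FiniteAtZero g)
    (hb : ∀ a b : ℝ, 0 < a → ∃ K, 0 ≤ K ∧ ∀ x ∈ Icc a b, g x ≤ K) (c : ℝ) :
    ∃ K, 0 ≤ K ∧ ∀ x, 0 < x → x ≤ c → g x ≤ K := by
  obtain ⟨L, hL⟩ := hg
  have h1 : ∀ᶠ x in 𝓝[>] 0, g x < L + 1 := hL.eventually_lt_const (by linarith)
  obtain ⟨δ, hδ, h2⟩ := mem_nhdsGT_iff_exists_Ioo_subset.mp h1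
  obtain ⟨K, hK, h3⟩ := hb δ c hδ
  refine ⟨max K (L + 1), hK.trans (le_max_left _ _), fun x hx hxc => ?_⟩
  rcases lt_or_ge x δ with h | h
  · exact (h2 ⟨hx, h⟩).le.trans (le_max_right _ _)
  · exact (h3 x ⟨h, hxc⟩).trans (le_max_left _ _)

theorem OperatorConvex.bddOn_Icc_transpose {f : ℝ → ℝ} (hf : OperatorConvex f) (a b : ℝ)
    (ha : 0 < a) : ∃ K, 0 ≤ K ∧ ∀ x ∈ Icc a b, transposeFun f x ≤ K := by
  -- `max a b` keeps the endpoint positive even if the interval is empty.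
  obtain ⟨K, hK, h⟩ := hf.bddOn_Icc (1 / max a b) (1 / a) (by positivity)
  refine ⟨max a b * K, by positivity, fun x hx => ?_⟩
  have hx0 : 0 < x := ha.trans_le hx.1
  have h1 := h (1 / x) ⟨one_div_le_one_div_of_le hx0 (hx.2.trans (le_max_right _ _)),
    one_div_le_one_div_of_le ha hx.1⟩
  exact (mul_le_mul_of_nonneg_left h1 hx0.le).trans
    (mul_le_mul_of_nonneg_right (hx.2.trans (le_max_right _ _)) hK)

/-- Since `f x = x * transposeFun f (1 / x)`, boundedness above of the transpose near zero is linear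
growth of `f` at infinity. -/
theorem OperatorConvex.le_mul_of_finiteAtZero_transpose {f : ℝ → ℝ} (hf : OperatorConvex f)
    (h : FiniteAtZero (transposeFun f)) {c : ℝ} (hc : 0 < c) :
    ∃ K, 0 ≤ K ∧ ∀ x, c ≤ x → f x ≤ K * x := by
  obtain ⟨K, hK, h1⟩ := h.bddOn_Ioc hf.bddOn_Icc_transpose (1 / c)
  refine ⟨K, hK, fun x hx => ?_⟩
  have hx0 : 0 < x := hc.trans_le hx
  have h2 := h1 (1 / x) (by positivity) (one_div_le_one_div_of_le hc hx)
  rw [transposeFun, one_div_one_div, one_div, inv_mul_le_iff₀ hx0] at h2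
  linarith

end Scalar

/-! ### Supports and existence of the perspective -/

section Support

variable {n p : Type*} [Fintype n] [DecidableEq n] [Fintype p] [DecidableEq p]

theorem continuousOn_spectrum (g : ℝ → ℝ) (A : Matrix n n ℂ) : ContinuousOn g (spectrum ℝ A) :=
  A.finite_real_spectrum.continuousOn g

theorem exists_le_smul_supp {A : Matrix n n ℂ} (hA : A.PosSemidef) :
    ∃ c : ℝ, 0 < c ∧ A ≤ c • supp A := by
  obtain ⟨c, hc⟩ := A.finite_real_spectrum.bddAbove
  refine ⟨max c 1, by positivity, ?_⟩
  rw [supp, ← cfc_smul (max c 1) (fun x : ℝ => if x = 0 then (0 : ℝ) else 1) A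
    (continuousOn_spectrum _ A)]
  conv_lhs => rw [← cfc_id ℝ A hA.isHermitian.isSelfAdjoint]
  refine cfc_mono (fun x hx => ?_) (continuousOn_spectrum _ A) (continuousOn_spectrum _ A)
  by_cases h : x = 0
  · simp [h]
  · simpa [h] using (Or.inl (hc hx) : x ≤ c ∨ x ≤ 1)

theorem exists_supp_le_smul {A : Matrix n n ℂ} (hA : A.PosSemidef) :
    ∃ c : ℝ, 0 < c ∧ supp A ≤ c • A := by
  obtain ⟨c, hc⟩ := (A.finite_real_spectrum.image (fun x => x⁻¹)).bddAbove
  refine ⟨max c 1, by positivity, ?_⟩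
  have h1 : max c 1 • A = cfc (fun x : ℝ => max c 1 • x) A := by
    rw [cfc_smul (max c 1) (fun x : ℝ => x) A (continuousOn_spectrum _ A),
      cfc_id' ℝ A hA.isHermitian.isSelfAdjoint]
  rw [supp, h1]
  refine cfc_mono (fun x hx => ?_) (continuousOn_spectrum _ A) (continuousOn_spectrum _ A)
  have hx0 : 0 ≤ x := spectrum_nonneg_of_nonneg hA.nonneg hx
  by_cases h : x = 0
  · simp [h]
  · have hx1 : 0 < x := lt_of_le_of_ne hx0 (Ne.symm h)
    have h2 : x⁻¹ ≤ max c 1 := (hc (Set.mem_image_of_mem _ hx)).trans (le_max_left _ _)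
    simp only [h, if_false, smul_eq_mul]
    exact (inv_le_iff_one_le_mul₀ hx1).mp h2

theorem isHermitian_supp (A : Matrix n n ℂ) : (supp A).IsHermitian := isHermitian_cfc _ _

theorem supp_mul_supp (A : Matrix n n ℂ) : supp A * supp A = supp A := by
  rw [supp, ← cfc_mul _ _ A (continuousOn_spectrum _ A) (continuousOn_spectrum _ A)]
  refine cfc_congr fun x _ => ?_
  by_cases h : x = 0 <;> simp [h]

theorem posSemidef_of_projection {P : Matrix n n ℂ} (hP : P.IsHermitian) (hPP : P * P = P) :
    P.PosSemidef := by
  have := Matrix.posSemidef_conjTranspose_mul_self P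
  rwa [hP.eq, hPP] at this

/-- Compressing to the range of `1 - Q` kills the right side, so `P = P * Q = Q * P`, and then `P =
Q * P * Q ≤ Q`. -/
theorem projection_le_of_le_smul {P Q : Matrix n n ℂ} (hP : P.IsHermitian) (hPP : P * P = P)
    (hQ : Q.IsHermitian) (hQQ : Q * Q = Q) {c : ℝ} (h : P ≤ c • Q) : P ≤ Q := by
  have hQ1 : (1 - Q).IsHermitian := Matrix.isHermitian_one.sub hQ
  have h1 := conj_mono h (1 - Q)
  have h2 : (1 - Q)ᴴ * (c • Q) * (1 - Q) = 0 := by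
    rw [hQ1.eq, Matrix.mul_smul, Matrix.sub_mul, hQQ]
    simp
  have h3 : (1 - Q)ᴴ * P * (1 - Q) = (P * (1 - Q))ᴴ * (P * (1 - Q)) := by
    rw [Matrix.conjTranspose_mul, hP.eq, Matrix.mul_assoc, Matrix.mul_assoc, ← Matrix.mul_assoc P P,
      hPP]
  rw [h2, h3] at h1
  have h4 := Matrix.conjTranspose_mul_self_eq_zero.mp
    (le_antisymm h1 (Matrix.posSemidef_conjTranspose_mul_self _).nonneg)
  rw [Matrix.mul_sub, Matrix.mul_one, sub_eq_zero] at h4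
  have h5 : P = Q * P := by
    have := congrArg Matrix.conjTranspose h4
    rwa [Matrix.conjTranspose_mul, hP.eq, hQ.eq] at this
  have h6 : P ≤ 1 := by
    rw [Matrix.le_iff]
    refine posSemidef_of_projection (Matrix.isHermitian_one.sub hP) ?_
    simp [Matrix.sub_mul, Matrix.mul_sub, hPP]
  have h7 := conj_mono h6 Q
  rwa [hQ.eq, Matrix.mul_one, hQQ, ← h5, ← h4] at h7

theorem smul_le_smul_matrix {A B : Matrix n n ℂ} (h : A ≤ B) {c : ℝ} (hc : 0 ≤ c) :
    c • A ≤ c • B := by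
  rw [Matrix.le_iff, ← smul_sub]
  exact (Matrix.le_iff.mp h).smul hc

/-- Each matrix and its support dominate one another up to a constant. In this form the support
order is visibly preserved by positive maps. -/
theorem supp_le_supp_iff {A B : Matrix n n ℂ} (hA : A.PosSemidef) (hB : B.PosSemidef) :
    supp A ≤ supp B ↔ ∃ c : ℝ, 0 < c ∧ A ≤ c • B := by
  constructor
  · intro h
    obtain ⟨a, ha, h1⟩ := exists_le_smul_supp hA
    obtain ⟨b, hb, h2⟩ := exists_supp_le_smul hB
    refine ⟨a * b, mul_pos ha hb, ?_⟩
    rw [mul_smul]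
    exact h1.trans (smul_le_smul_matrix (h.trans h2) ha.le)
  · rintro ⟨c, hc, h⟩
    obtain ⟨a, ha, h1⟩ := exists_supp_le_smul hA
    obtain ⟨b, hb, h2⟩ := exists_le_smul_supp hB
    refine projection_le_of_le_smul (c := a * (c * b)) (isHermitian_supp A) (supp_mul_supp A)
      (isHermitian_supp B) (supp_mul_supp B) ?_
    rw [mul_smul, mul_smul]
    exact h1.trans (smul_le_smul_matrix (h.trans (smul_le_smul_matrix h2 hc.le)) ha.le)

theorem supp_map_le {T : Matrix n n ℂ →ₗ[ℂ] Matrix p p ℂ}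
    (hT : ∀ Z, Z.PosSemidef → (T Z).PosSemidef) {A B : Matrix n n ℂ} (hA : A.PosSemidef)
    (hB : B.PosSemidef) (h : supp A ≤ supp B) : supp (T A) ≤ supp (T B) := by
  obtain ⟨c, hc, h1⟩ := (supp_le_supp_iff hA hB).mp h
  refine (supp_le_supp_iff (hT A hA) (hT B hB)).mpr ⟨c, hc, ?_⟩
  have := map_mono_of_posSemidef hT h1
  rwa [LinearMap.map_smul_of_tower] at this

theorem SupportCondition.map {f : ℝ → ℝ} {T : Matrix n n ℂ →ₗ[ℂ] Matrix p p ℂ}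
    (hT : ∀ Z, Z.PosSemidef → (T Z).PosSemidef) {A B : Matrix n n ℂ} (hA : A.PosSemidef)
    (hB : B.PosSemidef) (h : SupportCondition f A B) : SupportCondition f (T A) (T B) := by
  rcases h with h | h | ⟨h1, h2⟩ | ⟨h1, h2⟩
  · exact Or.inl (le_antisymm (supp_map_le hT hA hB h.le) (supp_map_le hT hB hA h.ge))
  · exact Or.inr (Or.inl h)
  · exact Or.inr (Or.inr (Or.inl ⟨h1, supp_map_le hT hA hB h2⟩))
  · exact Or.inr (Or.inr (Or.inr ⟨h1, supp_map_le hT hB hA h2⟩))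

theorem add_smul_one_le {A B : Matrix n n ℂ} {c : ℝ} (hB : B.PosSemidef) (h : A ≤ c • B) :
    ∀ ε : ℝ, 0 < ε → A + ε • 1 ≤ max c 1 • (B + ε • 1) := by
  intro ε hε
  rw [smul_add]
  refine add_le_add (h.trans ?_) ?_
  · rw [← sub_nonneg, ← sub_smul]
    exact (hB.smul (sub_nonneg.mpr (le_max_left c 1))).nonneg
  · rw [smul_smul, ← sub_nonneg, ← sub_smul]
    refine (Matrix.PosSemidef.one.smul ?_).nonneg
    nlinarith [le_max_right c 1]

theorem OperatorConvex.opPerspDefined_of_supportCondition {f : ℝ → ℝ} (hf : OperatorConvex f)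
    {A B : Matrix n n ℂ} (hA : A.PosSemidef) (hB : B.PosSemidef) (h : SupportCondition f A B) :
    OpPerspDefined f A B := by
  have h1 := Matrix.PosDef.one (n := n) (R := ℂ)
  -- Here `x` stands for any coefficient `l i` of the decomposition at `ε`. Summing `K * (1 + l i)`
  -- against `G i` gives `K • (A + B) + (2 * K * ε) • 1`, which is the required bound.
  suffices hK : ∃ K : ℝ, 0 ≤ K ∧ ∀ (ε : ℝ), 0 < ε → ∀ x : ℝ, 0 < x →
      (∀ c : ℝ, A + ε • 1 ≤ c • (B + ε • 1) → x ≤ c) →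
      (∀ c : ℝ, c • (B + ε • 1) ≤ A + ε • 1 → c ≤ x) → f x ≤ K * (1 + x) by
    obtain ⟨K, hK0, hK⟩ := hK
    refine hf.opPerspDefined_of_le (C := K • (A + B)) (W := (2 * K) • 1) hA hB fun ε hε => ?_
    obtain ⟨G, l, hG, hl, hGB, hGA, hP, hle, hge⟩ :=
      exists_decomposition f (posDef_add_smul hA h1 hε) (posDef_add_smul hB h1 hε)
    rw [hP]
    calc ∑ i, f (l i) • G i ≤ ∑ i, (K * (1 + l i)) • G i := by
          refine Finset.sum_le_sum fun i _ => ?_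
          rw [← sub_nonneg, ← sub_smul]
          exact ((hG i).smul (sub_nonneg.mpr
            (hK ε hε (l i) (hl i) (fun c hc => hle c hc i) fun c hc => hge c hc i))).nonneg
      _ = K • (A + B) + ε • (2 * K) • 1 := by
          simp only [mul_smul, add_smul, one_smul, ← Finset.smul_sum, Finset.sum_add_distrib, hGA,
            hGB]
          module
  have hlow : ∀ {c : ℝ}, B ≤ c • A → ∀ ε : ℝ, 0 < ε →
      (max c 1)⁻¹ • (B + ε • 1) ≤ A + ε • 1 := fun {c} hc ε hε => by
    have h2 := smul_le_smul_matrix (add_smul_one_le hA hc ε hε)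
      (c := (max c 1)⁻¹) (by positivity)
    rwa [smul_smul, inv_mul_cancel₀ (by positivity), one_smul] at h2
  -- Domination `A ≤ a • B` caps the coefficients and `B ≤ b • A` keeps them away from zero,
  -- uniformly in `ε`; finiteness at zero of `f` or of its transpose covers an end left free.
  rcases h with h | ⟨h2, h3⟩ | ⟨h2, h3⟩ | ⟨h2, h3⟩
  · obtain ⟨a, ha, hAB⟩ := (supp_le_supp_iff hA hB).mp h.le
    obtain ⟨b, hb, hBA⟩ := (supp_le_supp_iff hB hA).mp h.ge
    obtain ⟨K, hK, hKb⟩ := hf.bddOn_Icc (max b 1)⁻¹ (max a 1) (by positivity)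
    refine ⟨K, hK, fun ε hε x hx hx1 hx2 => ?_⟩
    have := hKb x ⟨hx2 _ (hlow hBA ε hε), hx1 _ (add_smul_one_le hB hAB ε hε)⟩
    nlinarith
  · obtain ⟨K, hK, hKb⟩ := h2.bddOn_Ioc hf.bddOn_Icc 1
    obtain ⟨K', hK', hKb'⟩ := hf.le_mul_of_finiteAtZero_transpose h3 one_pos
    refine ⟨K + K', by positivity, fun ε hε x hx hx1 hx2 => ?_⟩
    rcases le_total x 1 with hx3 | hx3
    · have := hKb x hx hx3
      nlinarith [mul_nonneg hK hx.le, mul_nonneg hK' hx.le]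
    · have := hKb' x hx3
      nlinarith [mul_nonneg hK hx.le, mul_nonneg hK' hx.le]
  · obtain ⟨a, ha, hAB⟩ := (supp_le_supp_iff hA hB).mp h3
    obtain ⟨K, hK, hKb⟩ := h2.bddOn_Ioc hf.bddOn_Icc (max a 1)
    refine ⟨K, hK, fun ε hε x hx hx1 hx2 => ?_⟩
    have := hKb x hx (hx1 _ (add_smul_one_le hB hAB ε hε))
    nlinarith
  · obtain ⟨b, hb, hBA⟩ := (supp_le_supp_iff hB hA).mp h3
    obtain ⟨K, hK, hKb⟩ := hf.le_mul_of_finiteAtZero_transpose h2 (c := (max b 1)⁻¹) (by positivity)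
    refine ⟨K, hK, fun ε hε x hx hx1 hx2 => ?_⟩
    have := hKb x (hx2 _ (hlow hBA ε hε))
    nlinarith

end Support

/-! ### Complete positivity, Kraus forms and Choi's theorem -/

section CompletePositivity

open scoped Matrix.Norms.L2Operator

variable {m n k l : Type*} [Fintype m] [DecidableEq m] [Fintype n] [DecidableEq n] [Fintype k]
  [DecidableEq k] [Fintype l] [DecidableEq l]

/-- The block matrix with blocks `X a b`, as a matrix over `ℂ`. -/
def flatten {m n : Type*} (X : CStarMatrix m m (Matrix n n ℂ)) : Matrix (m × n) (m × n) ℂ :=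
  Matrix.of fun p q => X p.1 q.1 p.2 q.2

theorem flatten_star_mul_self (Z : CStarMatrix m m (Matrix n n ℂ)) :
    flatten (star Z * Z) = (flatten Z)ᴴ * flatten Z := by
  ext ⟨a, i⟩ ⟨b, j⟩
  simp only [flatten, Matrix.of_apply, CStarMatrix.mul_apply, CStarMatrix.star_apply,
    Matrix.sum_apply, Matrix.mul_apply, Matrix.star_apply, Matrix.conjTranspose_apply,
    Fintype.sum_prod_type]

/-- Flattening respects `star Z * Z`, and such elements generate both cones. -/
theorem cstarMatrix_nonneg_iff (X : CStarMatrix m m (Matrix n n ℂ)) :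
    0 ≤ X ↔ (flatten X).PosSemidef := by
  constructor
  · intro h
    induction StarOrderedRing.nonneg_iff.mp h using AddSubmonoid.closure_induction with
    | mem X hX =>
      obtain ⟨Z, rfl⟩ := hX
      rw [flatten_star_mul_self]
      exact Matrix.posSemidef_conjTranspose_mul_self _
    | zero => exact Matrix.PosSemidef.zero
    | add X Y hX hY h1 h2 =>
      exact (h1 (StarOrderedRing.nonneg_iff.mpr hX)).add (h2 (StarOrderedRing.nonneg_iff.mpr hY))
  · intro h
    obtain ⟨W, hW⟩ := CStarAlgebra.nonneg_iff_eq_star_mul_self.mp h.nonneg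
    let Z : CStarMatrix m m (Matrix n n ℂ) := fun a b => Matrix.of fun i j => W (a, i) (b, j)
    have hX : X = star Z * Z := by
      have h1 : flatten X = flatten (star Z * Z) := by
        rw [hW, flatten_star_mul_self]
        rfl
      ext a b i j
      exact congrFun (congrFun h1 (a, i)) (b, j)
    rw [hX]
    exact star_mul_self_nonneg Z

theorem isCP_iff {N : SuperOp n k} :
    IsCP N ↔ ∀ (r : ℕ) (X : CStarMatrix (Fin r) (Fin r) (Matrix n n ℂ)),
      (flatten X).PosSemidef → (flatten (X.map N)).PosSemidef := by
  constructor
  · rintro ⟨φ, rfl⟩ r X hX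
    exact (cstarMatrix_nonneg_iff _).mp
      (φ.map_cstarMatrix_nonneg' r X ((cstarMatrix_nonneg_iff X).mpr hX))
  · intro h
    exact ⟨⟨N, fun r X hX =>
      (cstarMatrix_nonneg_iff _).mpr (h r X ((cstarMatrix_nonneg_iff X).mp hX))⟩, rfl⟩

theorem IsCP.comp {F : SuperOp k l} {N : SuperOp n k} (hF : IsCP F) (hN : IsCP N) :
    IsCP (F ∘ₗ N) := by
  rw [isCP_iff] at *
  exact fun r X hX => hF r (X.map N) (hN r X hX)

theorem isCP_of_kraus {ι : Type*} [Fintype ι] {N : SuperOp n k} (K : ι → Matrix k n ℂ)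
    (hN : ∀ ρ, N ρ = ∑ c, K c * ρ * (K c)ᴴ) : IsCP N := by
  rw [isCP_iff]
  intro r X hX
  let L : ι → Matrix (Fin r × k) (Fin r × n) ℂ := fun c =>
    Matrix.kroneckerMap (· * ·) 1 (K c)
  have h : flatten (X.map N) = ∑ c, L c * flatten X * (L c)ᴴ := by
    ext ⟨a, i⟩ ⟨b, j⟩
    change N (X a b) i j = _
    rw [hN, Matrix.sum_apply, Matrix.sum_apply]
    refine Finset.sum_congr rfl fun c _ => ?_
    simp [L, flatten, Matrix.mul_apply, Fintype.sum_prod_type, Matrix.one_apply, Finset.sum_mul,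
      apply_ite]
  rw [h]
  exact Matrix.posSemidef_sum _ fun c _ => hX.mul_mul_conjTranspose_same (L c)

theorem isCP_conj (V : Matrix k n ℂ) {N : SuperOp n k} (hN : ∀ ρ, N ρ = V * ρ * Vᴴ) : IsCP N :=
  isCP_of_kraus (fun _ : Unit => V) fun ρ => by simp [hN]

theorem isCP_blockAt (a : m) : IsCP (blockAt (n := n) a a) := by
  refine isCP_conj (Matrix.of fun i q => if q = (a, i) then 1 else 0) fun ρ => ?_
  ext i j
  simp [Matrix.mul_apply, apply_ite]
  rfl

theorem isCP_embedAt (a : m) : IsCP (embedAt (n := n) a a) := by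
  refine isCP_conj (Matrix.of fun q i => (if a = q.1 then 1 else 0) * (1 : Matrix n n ℂ) q.2 i)
    fun ρ => ?_
  ext ⟨b, i⟩ ⟨c, j⟩
  have h : embedAt a a ρ (b, i) (c, j) = Matrix.single a a (1 : ℂ) b c * ρ i j := rfl
  rw [h]
  rcases eq_or_ne a b with rfl | hb <;> rcases eq_or_ne a c with rfl | hc <;>
    simp [Matrix.mul_apply, Matrix.one_apply, apply_ite (starRingEnd ℂ), *]

/-- Choi's theorem. -/
theorem isCP_iff_posSemidef_choi (Ψ : ChoiVector m n) {N : SuperOp n k} :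
    IsCP N ↔ (choi Ψ N).PosSemidef := by
  constructor
  · rintro ⟨φ, rfl⟩
    have h := φ.map_cstarMatrix_nonneg (n := m) (fun a b => blockAt a b Ψ.proj)
      ((cstarMatrix_nonneg_iff _).mpr (Matrix.posSemidef_vecMulVec_self_star Ψ.vec))
    rw [cstarMatrix_nonneg_iff] at h
    convert h using 1
    ext ⟨a, i⟩ ⟨b, j⟩
    exact congrFun (congrFun (blockAt_idTensor φ.toLinearMap Ψ.proj a b) i) j
  · intro h
    obtain ⟨W, hW⟩ := CStarAlgebra.nonneg_iff_eq_star_mul_self.mp h.nonneg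
    -- The rows of `W`, conjugated and reshaped, are Kraus operators up to `V`, the conjugate of the
    -- unitary given by `Ψ`, which undoes the Choi isomorphism.
    let P : m × k → Matrix k m ℂ := fun c => Matrix.of fun i a => star (W c (a, i))
    let V : Matrix m n ℂ := Matrix.of fun a x => star (Ψ.vec (a, x))
    refine isCP_of_kraus (fun c => P c * V) fun ρ => ?_
    have hS : ∀ a b, ∑ i, ∑ j, star (Ψ.vec (a, i)) * ρ i j * Ψ.vec (b, j) = (V * ρ * Vᴴ) a b := by
      intro a b
      simp only [Matrix.mul_apply, Finset.sum_mul, Matrix.conjTranspose_apply, V, Matrix.of_apply,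
        star_star]
      rw [Finset.sum_comm]
    have h1 : N ρ = ∑ a, ∑ b,
        (∑ i, ∑ j, star (Ψ.vec (a, i)) * ρ i j * Ψ.vec (b, j)) • blockAt a b (choi Ψ N) :=
      (LinearMap.congr_fun ((choi Ψ).symm_apply_apply N) ρ).symm
    have h2 : ∀ c, P c * V * ρ * (P c * V)ᴴ = P c * (V * ρ * Vᴴ) * (P c)ᴴ := fun c => by
      simp only [Matrix.conjTranspose_mul, Matrix.mul_assoc]
    simp only [h1, hS, h2]
    generalize V * ρ * Vᴴ = S
    ext i j
    have h3 : ∀ a b, blockAt a b (choi Ψ N) i j = ∑ c, star (W c (a, i)) * W c (b, j) :=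
      fun a b => congrFun (congrFun hW (a, i)) (b, j)
    simp only [Matrix.sum_apply, Matrix.smul_apply, h3, Matrix.mul_apply,
      Matrix.conjTranspose_apply, P, Matrix.of_apply, star_star, smul_eq_mul, Finset.mul_sum,
      Finset.sum_mul]
    rw [Finset.sum_comm]
    refine (Finset.sum_congr rfl fun b _ => Finset.sum_comm).trans ?_
    rw [Finset.sum_comm]
    refine Finset.sum_congr rfl fun c _ => Finset.sum_congr rfl fun b _ =>
      Finset.sum_congr rfl fun a _ => ?_
    ring

end CompletePositivity

/-! ### Transfer to superoperators and supermaps -/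

section Superoperators

variable {m m' n k n₂ k₂ : Type*} [Fintype m] [DecidableEq m] [Fintype m'] [DecidableEq m']
  [Fintype n] [DecidableEq n] [Fintype k] [DecidableEq k] [Fintype n₂] [DecidableEq n₂]
  [Fintype k₂] [DecidableEq k₂]

theorem posSemidef_choi_map {Θ : Supermap n k n₂ k₂} (hΘ : Θ.PreservesCP) (Ψ : ChoiVector m n)
    (Φ : ChoiVector m' n₂) (Z : Matrix (m × k) (m × k) ℂ) (hZ : Z.PosSemidef) :
    (((choi Φ).toLinearMap ∘ₗ Θ ∘ₗ (choi Ψ).symm.toLinearMap) Z).PosSemidef := by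
  refine (isCP_iff_posSemidef_choi Φ).mp (hΘ _ ((isCP_iff_posSemidef_choi Ψ).mpr ?_))
  simpa using hZ

theorem lecp_iff (Φ : ChoiVector m n) {N M : SuperOp n k} :
    LECP N M ↔ choi Φ N ≤ choi Φ M := by
  rw [LECP, isCP_iff_posSemidef_choi Φ, map_sub, Matrix.le_iff]

theorem LECP.antisymm (Φ : ChoiVector m n) {N M : SuperOp n k} (h1 : LECP N M) (h2 : LECP M N) :
    N = M :=
  (choi Φ).injective (le_antisymm ((lecp_iff Φ).mp h1) ((lecp_iff Φ).mp h2))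

/-- The map `C_Φ ∘ Θ ∘ C_Ψ⁻¹` is positive, so `opPersp_map_le` applies to it. -/
theorem OperatorConvex.superPersp_map_le {f : ℝ → ℝ} (hf : OperatorConvex f) {N M : SuperOp n k}
    (hN : IsCP N) (hM : IsCP M) {Ψ : ChoiVector m n} (hd : SuperPerspDefined Ψ f N M)
    {Θ : Supermap n k n₂ k₂} (hΘ : Θ.PreservesCP) (Φ : ChoiVector m' n₂) :
    SuperPerspDefined Φ f (Θ N) (Θ M) ∧
      LECP (superPersp Φ f (Θ N) (Θ M)) (Θ (superPersp Ψ f N M)) := by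
  have h := hf.opPersp_map_le (posSemidef_choi_map hΘ Ψ Φ) ((isCP_iff_posSemidef_choi Ψ).mp hN)
    ((isCP_iff_posSemidef_choi Ψ).mp hM) hd
  simp only [LinearMap.comp_apply, LinearEquiv.coe_coe, LinearEquiv.symm_apply_apply] at h
  refine ⟨h.1, (lecp_iff Φ).mpr ?_⟩
  rw [superPersp, LinearEquiv.apply_symm_apply]
  exact h.2

/-- Take one-dimensional ancillas and identify `ℂ ⊗ ℂ^n` with `ℂ^n` by `embedAt 0 0` and `blockAt 0
0`, both completely positive. -/
theorem Supermap.IsCPSupermap.preservesCP {Θ : Supermap n k n₂ k₂} (hΘ : Θ.IsCPSupermap) :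
    Θ.PreservesCP := by
  intro Λ hΛ
  have h := hΘ 1 1 (embedAt 0 0 ∘ₗ Λ ∘ₗ blockAt 0 0)
    ((isCP_embedAt 0).comp (hΛ.comp (isCP_blockAt 0)))
  have h1 := (isCP_blockAt (0 : Fin 1)).comp (h.comp (isCP_embedAt (0 : Fin 1)))
  have h2 : blockAt (0 : Fin 1) 0 ∘ₗ (embedAt 0 0 ∘ₗ Λ ∘ₗ blockAt 0 0) ∘ₗ embedAt 0 0 = Λ :=
    LinearMap.ext fun x => by simp [blockAt_embedAt]
  convert h1 using 1
  refine LinearMap.ext fun x => ?_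
  simp only [Supermap.idTensor, Fin.isValue, Finset.univ_unique, Fin.default_eq_zero,
    Finset.sum_singleton, LinearMap.comp_apply, blockAt_embedAt, and_self, if_true]
  exact (LinearMap.congr_fun (congrArg Θ h2) x).symm

theorem preservesCP_postcomp {l : Type*} [Fintype l] [DecidableEq l] {F : SuperOp k l}
    (hF : IsCP F) : Supermap.PreservesCP (LinearMap.compRight ℂ F : Supermap n k n l) :=
  fun _ hΛ => hF.comp hΛ

theorem preservesCP_precomp {l : Type*} [Fintype l] [DecidableEq l] {E : SuperOp l n}
    (hE : IsCP E) :
    Supermap.PreservesCP (LinearMap.lcomp ℂ (Matrix k k ℂ) E : Supermap n k l k) :=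
  fun _ hΛ => hΛ.comp hE

theorem preservesCP_id : Supermap.PreservesCP (LinearMap.id : Supermap n k n k) :=
  fun _ hΛ => hΛ

theorem OperatorConvex.superPersp_eq {f : ℝ → ℝ} (hf : OperatorConvex f) {N M : SuperOp n k}
    (hN : IsCP N) (hM : IsCP M) {Ψ : ChoiVector m n} (hd : SuperPerspDefined Ψ f N M)
    (Φ : ChoiVector m' n) : superPersp Φ f N M = superPersp Ψ f N M := by
  have h1 := hf.superPersp_map_le hN hM hd preservesCP_id Φ
  have h2 := hf.superPersp_map_le hN hM h1.1 preservesCP_id Ψ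
  exact LECP.antisymm Φ h1.2 h2.2

end Superoperators

end SuperPersp

/-! ### The main theorem -/

theorem mainTheorem12
    {h k : Type*} [Fintype h] [DecidableEq h] [Fintype k] [DecidableEq k]
    (f : ℝ → ℝ) (hf : OperatorConvex f)
    (N M : SuperOp h k) (hN : IsCP N) (hM : IsCP M)
    {h' : Type*} [Fintype h'] [DecidableEq h'] (Ψ : ChoiVector h' h)
    (hS : SupportCondition f (choi Ψ N) (choi Ψ M)) :
    -- `P_f(N, M)` is defined, and nothing depends on the choice of the Choi vector
    (∀ {m : Type*} [Fintype m] [DecidableEq m] (Φ : ChoiVector m h),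
      SupportCondition f (choi Φ N) (choi Φ M) ∧
      SuperPerspDefined Φ f N M ∧
      superPersp Φ f N M = superPersp Ψ f N M) ∧
    -- post-processing
    (∀ {l : Type*} [Fintype l] [DecidableEq l] (F : SuperOp k l), IsCP F →
      ∀ {m : Type*} [Fintype m] [DecidableEq m] (Φ : ChoiVector m h),
        SuperPerspDefined Φ f (F ∘ₗ N) (F ∘ₗ M) ∧
        LECP (superPersp Φ f (F ∘ₗ N) (F ∘ₗ M)) (F ∘ₗ superPersp Ψ f N M) ∧
        ((∃ G : SuperOp l k, IsCP G ∧ G ∘ₗ F = LinearMap.id ∧ F ∘ₗ G = LinearMap.id) →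
          superPersp Φ f (F ∘ₗ N) (F ∘ₗ M) = F ∘ₗ superPersp Ψ f N M)) ∧
    -- pre-processing
    (∀ {l : Type*} [Fintype l] [DecidableEq l] (E : SuperOp l h), IsCP E →
      ∀ {m : Type*} [Fintype m] [DecidableEq m] (Φ : ChoiVector m l),
        SuperPerspDefined Φ f (N ∘ₗ E) (M ∘ₗ E) ∧
        LECP (superPersp Φ f (N ∘ₗ E) (M ∘ₗ E)) (superPersp Ψ f N M ∘ₗ E)) ∧
    -- completely positive supermaps
    (∀ {h₂ k₂ : Type*} [Fintype h₂] [DecidableEq h₂] [Fintype k₂] [DecidableEq k₂]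
      (Θ : Supermap h k h₂ k₂), Θ.IsCPSupermap →
      ∀ {m : Type*} [Fintype m] [DecidableEq m] (Φ : ChoiVector m h₂),
        SuperPerspDefined Φ f (Θ N) (Θ M) ∧
        LECP (superPersp Φ f (Θ N) (Θ M)) (Θ (superPersp Ψ f N M))) ∧
    -- more generally, supermaps that preserve complete positivity of superoperators
    (∀ {h₂ k₂ : Type*} [Fintype h₂] [DecidableEq h₂] [Fintype k₂] [DecidableEq k₂]
      (Θ : Supermap h k h₂ k₂), Θ.PreservesCP →
      ∀ {m : Type*} [Fintype m] [DecidableEq m] (Φ : ChoiVector m h₂),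
        SuperPerspDefined Φ f (Θ N) (Θ M) ∧
        LECP (superPersp Φ f (Θ N) (Θ M)) (Θ (superPersp Ψ f N M))) := by

  have hd : SuperPerspDefined Ψ f N M :=
    hf.opPerspDefined_of_supportCondition ((isCP_iff_posSemidef_choi Ψ).mp hN)
      ((isCP_iff_posSemidef_choi Ψ).mp hM) hS
  refine ⟨?_, ?_, ?_, ?_, ?_⟩
  · intro m _ _ Φ
    refine ⟨?_, (hf.superPersp_map_le hN hM hd preservesCP_id Φ).1, hf.superPersp_eq hN hM hd Φ⟩
    have := hS.map (posSemidef_choi_map preservesCP_id Ψ Φ) ((isCP_iff_posSemidef_choi Ψ).mp hN)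
      ((isCP_iff_posSemidef_choi Ψ).mp hM)
    simpa using this
  · intro l _ _ F hF m _ _ Φ
    have h := hf.superPersp_map_le hN hM hd (preservesCP_postcomp hF) Φ
    refine ⟨h.1, h.2, fun ⟨G, hG, hGF, hFG⟩ => LECP.antisymm Φ h.2 ?_⟩
    -- Monotonicity under the inverse `G`, applied to `F ∘ₗ N` and `F ∘ₗ M`, bounds `P_f(N, M)` by
    -- `G ∘ₗ P_f(F ∘ₗ N, F ∘ₗ M)`; composing with `F` gives the reverse inequality.
    have h1 := (hf.superPersp_map_le (hF.comp hN) (hF.comp hM) h.1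
      (preservesCP_postcomp hG) Ψ).2
    have h2 : LECP (superPersp Ψ f (G ∘ₗ F ∘ₗ N) (G ∘ₗ F ∘ₗ M))
      (G ∘ₗ superPersp Φ f (F ∘ₗ N) (F ∘ₗ M)) := h1
    rw [← LinearMap.comp_assoc, ← LinearMap.comp_assoc, hGF, LinearMap.id_comp,
      LinearMap.id_comp] at h2
    have h3 := hF.comp h2
    rwa [LinearMap.comp_sub, ← LinearMap.comp_assoc, hFG, LinearMap.id_comp] at h3
  · intro l _ _ E hE m _ _ Φ
    exact hf.superPersp_map_le hN hM hd (preservesCP_precomp hE) Φ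
  · intro h₂ k₂ _ _ _ _ Θ hΘ m _ _ Φ
    exact hf.superPersp_map_le hN hM hd hΘ.preservesCP Φ
  · intro h₂ k₂ _ _ _ _ Θ hΘ m _ _ Φ
    exact hf.superPersp_map_le hN hM hd hΘ Φ
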